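/- Let $\mathbb K$ be a field. For a finite simple graph $G$, let $S=\mathbb K[x_v : v\in V(G)]$, with every variable of degree $1$, and let the cover ideal of $G$ be $$J(G)=\Big(\prod_{v\in C}x_v \;\Big|\; C\text{ is a minimal vertex cover of }G\Big)\subseteq S .$$ For a monomial ideal $I\neq 0$, let $\deg(I)$ be the maximum degree of a minimal monomial generator of $I$. For an ideal $I$ of $S$ and $k\ge 1$, let $$I^{(k)}=\bigcap_{\mathfrak p\in \mathrm{Min}(I)}\ker\big(S\to (S/I^k)_{\mathfrak p}\big)$$ be the $k$-th symbolic power of $I$, where $\mathrm{Min}(I)$ is the set of minimal primes of $I$. For a nonzero homogeneous ideal $I$ with minimal graded free resolution $\cdots\to\bigoplus_j S(-j)^{\beta_{1,j}(I)}\to\bigoplus_j S(-j)^{\beta_{0,j}(I)}\to I\to 0$, let $\mathrm{reg}(I)=\max\{j-i \mid \beta_{i,j}(I)\neq 0\}$ be its Castelnuovo–Mumford regularity. **Corollary.** Let $H$ be a finite simple graph whose independence number (the largest cardinality of a set of pairwise non-adjacent vertices) is at most $2$, and let $G$ be the cone over $H$, that is, the graph obtained from $H$ by adding a new vertex $y$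 and connecting $y$ to every vertex of $H$. Then for every integer $k\ge 1$, $$\mathrm{reg}(J(G)^{(k)})=k\deg(J(G))=(k-1)\deg(J(G))+|V(G)|-1 .$$ In particular, for the complete graph $K_n$, $\mathrm{reg}(J(K_n)^{(k)})=k(n-1)$ for all integers $n\ge 2$ and $k\ge 1$. -/

import Mathlib

noncomputable section

namespace CoverIdeals

open MvPolynomial

/-! ### Graphs and cover ideals -/

/-- The cone over a graph `H`: a new vertex `none` is added and joined to every vertex of `H`. -/
def cone {V : Type*} (H : SimpleGraph V) : SimpleGraph (Option V) where
  Adj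
    | none, none => False
    | none, some _ => True
    | some _, none => True
    | some v, some w => H.Adj v w
  symm := ⟨by
    rintro (_ | v) (_ | w) h
    · exact h
    · trivial
    · trivial
    · exact H.symm.symm _ _ h⟩
  loopless := ⟨by
    rintro (_ | v) h
    · exact h
    · exact H.loopless.irrefl v h⟩

/-- The cover ideal `J(G)` in `K[x_v : v ∈ V]`: it is generated by the products `∏_{v ∈ C} x_v`,
where `C` runs over the minimal vertex covers of `G`. -/
def coverIdeal (K : Type*) [Field K] {V : Type*} (G : SimpleGraph V) :
    Ideal (MvPolynomial V K) :=
  Ideal.span {f | ∃ C : Finset V,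
    Minimal (fun D : Finset V => G.IsVertexCover (D : Set V)) C ∧ f = ∏ v ∈ C, X v}

/-! ### Symbolic powers -/

/-- The `k`-th symbolic power `I^(k)`: the intersection, over the minimal primes `p` of `I`, of the
kernels of the canonical maps `R → (R / I^k)_p`. -/
def symbolicPower {R : Type*} [CommRing R] (I : Ideal R) (k : ℕ) : Ideal R :=
  ⨅ (p : Ideal R) (hp : p ∈ I.minimalPrimes),
    haveI : p.IsPrime := hp.1.1
    LinearMap.ker
      ((LocalizedModule.mkLinearMap p.primeCompl (R ⧸ I ^ k)).comp (I ^ k).mkQ)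

/-! ### The degree of a monomial ideal -/

/-- The exponents of the minimal monomials of an ideal `I`, that is, of the monomials in `I` that
are minimal with respect to divisibility. For a monomial ideal `I` these are the minimal monomial
generators of `I`. -/
def minimalMonomials {K σ : Type*} [Field K] (I : Ideal (MvPolynomial σ K)) : Set (σ →₀ ℕ) :=
  {m | Minimal (fun m' : σ →₀ ℕ => monomial m' (1 : K) ∈ I) m}

theorem minimalMonomials_finite {K σ : Type*} [Field K] [Finite σ]
    (I : Ideal (MvPolynomial σ K)) : (minimalMonomials I).Finite :=
  WellQuasiOrderedLE.finite_of_isAntichain (setOfPred_minimal_antichain _)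

/-- The degree of a monomial ideal: the maximum of the (total) degrees of its minimal monomial
generators. -/
def monomialIdealDegree {K σ : Type*} [Field K] [Finite σ] (I : Ideal (MvPolynomial σ K)) : ℕ :=
  (minimalMonomials_finite I).toFinset.sup Finsupp.degree

/-! ### Minimal graded free resolutions and regularity -/

/-- A minimal graded free resolution
`⋯ → F₂ → F₁ → F₀ → I → 0`
of an ideal `I` of the standard graded ring `S = K[x_s : s ∈ σ]`, where
`F_i = ⨁_{a < rank i} S(-shift i a)`. The maps are given by matrices in the standard bases.
(Finite resolutions are those with `rank i = 0` for all large `i`.) -/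
structure MinimalGradedFreeResolution {K σ : Type*} [Field K] (I : Ideal (MvPolynomial σ K)) where
  /-- the rank of `F_i` -/
  rank : ℕ → ℕ
  /-- the degrees of the basis elements of `F_i` -/
  shift : ∀ i, Fin (rank i) → ℕ
  /-- the augmentation `F₀ → I`: the images of the basis elements of `F₀` -/
  gen : Fin (rank 0) → MvPolynomial σ K
  /-- the matrix of the differential `F_{i+1} → F_i` -/
  d : ∀ i, Matrix (Fin (rank i)) (Fin (rank (i + 1))) (MvPolynomial σ K)
  /-- the augmentation preserves degrees -/
  gen_homogeneous : ∀ a, (gen a).IsHomogeneous (shift 0 a)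
  /-- the differentials preserve degrees: each nonzero entry at row `b` and column `a` is
  homogeneous of degree `shift (i + 1) a - shift i b` -/
  d_homogeneous : ∀ i b a, ∀ m ∈ (d i b a).support,
    Finsupp.degree m + shift i b = shift (i + 1) a
  /-- the augmentation maps `F₀` onto `I` -/
  range_gen : LinearMap.range (Fintype.linearCombination (MvPolynomial σ K) gen) = I
  /-- exactness at `F₀` -/
  exact_zero : Function.Exact (d 0).mulVecLin (Fintype.linearCombination (MvPolynomial σ K) gen)
  /-- exactness at `F_{i+1}` -/
  exact_succ : ∀ i, Function.Exact (d (i + 1)).mulVecLin (d i).mulVecLin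
  /-- minimality: all entries of the differentials lie in the maximal ideal `(x_s : s ∈ σ)` -/
  minimal : ∀ i b a, constantCoeff (d i b a) = 0

/-- The graded Betti number `β_{i,j}`: the number of summands `S(-j)` in `F_i`. -/
def MinimalGradedFreeResolution.betti {K σ : Type*} [Field K] {I : Ideal (MvPolynomial σ K)}
    (F : MinimalGradedFreeResolution I) (i j : ℕ) : ℕ :=
  (Finset.univ.filter fun a : Fin (F.rank i) => F.shift i a = j).card

/-- `IsRegularity I r` says that `reg(I) = max {j - i | β_{i,j}(I) ≠ 0}` is equal to `r`, where the
graded Betti numbers are read off from the minimal graded free resolution of `I` (which exists,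
and any choice of which has this maximum equal to `r`). -/
def IsRegularity {K σ : Type*} [Field K] (I : Ideal (MvPolynomial σ K)) (r : ℤ) : Prop :=
  Nonempty (MinimalGradedFreeResolution I) ∧
    ∀ F : MinimalGradedFreeResolution I,
      IsGreatest {m : ℤ | ∃ i j : ℕ, F.betti i j ≠ 0 ∧ m = (j : ℤ) - (i : ℤ)} r

end CoverIdeals

end

/-! Localizing at the minimal primes of `J(G)`, which are the ideals `(x_v, x_w)` of the edges,
shows that `J(G)^(k)` consists of the polynomials all of whose exponents satisfy `k ≤ m v + m w` on
every edge (`mem_symbolicPower_coverIdeal_iff`). Let `|V(G)| = n + 1`. If `y` is a universal vertex,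
the exponent with value `0` at `y` and `k` elsewhere is minimal (`minimal_topExp`), so `F_0` has a
generator of degree `kn`; for `k = 1` no minimal exponent has larger degree, so `deg J(G) = n`. It
remains to bound the shifts of `F_i` by `kn + i` (`shift_le`), which works for every graph on `n +
1` vertices.

The bound comes from computing Tor by the Koszul complex. Dimension shifting along the resolution
turns a basis element of `F_i` into a Koszul cycle over the ideal that does not bound. It must
involve a multidegree `b` in which no variable `x_v` with `b v ≠ 0` gives a contracting homotopy
inside the ideal (`exists_multidegree_succ`, `exists_multidegree_zero`). For each such `v` there is
then an admissible exponent that stops being admissible when lowered at `v`, hence a tight edge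
`vw`: `b v + b w` is `k`, or it is `k + 1` with `b w ≠ 0`. Comparison with the smallest entry of `b`
bounds its degree by `kn + 1`, and by `kn` when `i = 0` (`sum_le_of_forall_adj_or`,
`sum_le_of_forall_adj`).

A minimal resolution exists because one can iterate syzygies, each time with the least possible
number of homogeneous generators (`exists_minimal_generators`). -/

noncomputable section

namespace CoverIdeals

open MvPolynomial

/-! ### Restricting the support of a polynomial -/

section Keep

variable {K σ : Type*} [Field K]

open Classical in
/-- The part of a polynomial supported on the monomials satisfying `P`. -/
def keep (P : (σ →₀ ℕ) → Prop) (p : MvPolynomial σ K) : MvPolynomial σ K :=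
  ∑ m ∈ p.support with P m, monomial m (coeff m p)

theorem coeff_keep (P : (σ →₀ ℕ) → Prop) (p : MvPolynomial σ K) (m : σ →₀ ℕ)
    [Decidable (P m)] : coeff m (keep P p) = if P m then coeff m p else 0 := by
  classical
  simp only [keep, coeff_sum, coeff_monomial, Finset.sum_ite_eq', Finset.mem_filter, mem_support_iff]
  by_cases h : coeff m p = 0 <;> simp [h]

theorem coeff_keep_ne_zero {P : (σ →₀ ℕ) → Prop} {p : MvPolynomial σ K} {m : σ →₀ ℕ}
    (h : coeff m (keep P p) ≠ 0) : P m ∧ coeff m p ≠ 0 := by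
  classical
  rw [coeff_keep] at h
  by_cases hP : P m <;> simp_all

theorem keep_zero (P : (σ →₀ ℕ) → Prop) : keep P (0 : MvPolynomial σ K) = 0 := by
  simp [keep]

theorem keep_sum {ι : Type*} (P : (σ →₀ ℕ) → Prop) (s : Finset ι) (p : ι → MvPolynomial σ K) :
    keep P (∑ i ∈ s, p i) = ∑ i ∈ s, keep P (p i) := by
  classical
  ext m
  simp only [coeff_sum, coeff_keep]
  split_ifs <;> simp

theorem keep_zsmul (P : (σ →₀ ℕ) → Prop) (c : ℤ) (p : MvPolynomial σ K) :
    keep P (c • p) = c • keep P p := by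
  classical
  ext m
  rw [coeff_keep, coeff_smul, coeff_smul, coeff_keep]
  split_ifs <;> simp

/-- The common source of compatibility with gradings: a factor whose exponents all shift `Q` to `P`
carries the `Q`-part of `p` to the `P`-part of the product. It serves both the multigrading of the
Koszul complex and the total degree. -/
theorem keep_mul {P Q : (σ →₀ ℕ) → Prop} {q : MvPolynomial σ K}
    (h : ∀ n ∈ q.support, ∀ m, P (n + m) ↔ Q m) (p : MvPolynomial σ K) :
    keep P (q * p) = q * keep Q p := by
  classical
  ext m
  rw [coeff_keep, coeff_mul, coeff_mul]
  have key : ∀ x ∈ Finset.HasAntidiagonal.antidiagonal m, coeff x.1 q * coeff x.2 (keep Q p) =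
      if P m then coeff x.1 q * coeff x.2 p else 0 := by
    intro x hx
    rw [Finset.HasAntidiagonal.mem_antidiagonal] at hx
    by_cases hq : coeff x.1 q = 0
    · simp [hq]
    · have := h x.1 (mem_support_iff.2 hq) x.2
      rw [hx] at this
      rw [coeff_keep]
      simp [this]
  rw [Finset.sum_congr rfl key]
  split_ifs <;> simp

theorem exists_eq_X_mul {v : σ} {p : MvPolynomial σ K} (h : ∀ m, coeff m p ≠ 0 → m v ≠ 0) :
    ∃ q, p = X v * q := by
  have : (X v : MvPolynomial σ K) ∣ p := by
    rw [X_dvd_iff_modMonomial_eq_zero]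
    ext m
    by_cases hm : Finsupp.single v 1 ≤ m
    · rw [coeff_modMonomial_of_le _ hm, coeff_zero]
    · rw [coeff_modMonomial_of_not_le _ hm, coeff_zero]
      by_contra h'
      exact hm (Finsupp.single_le_iff.2 (Nat.one_le_iff_ne_zero.2 (h m h')))
  exact this

/-- The exponent of the squarefree monomial with support `τ`. -/
def faceExp (τ : Finset σ) : σ →₀ ℕ := ∑ v ∈ τ, Finsupp.single v 1

theorem degree_faceExp (τ : Finset σ) : (faceExp τ).degree = τ.card := by
  simp [faceExp, map_sum]

theorem faceExp_insert [DecidableEq σ] {v : σ} {τ : Finset σ} (h : v ∉ τ) :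
    faceExp (insert v τ) = Finsupp.single v 1 + faceExp τ := by
  rw [faceExp, Finset.sum_insert h, faceExp]

theorem faceExp_apply_of_notMem {v : σ} {τ : Finset σ} (h : v ∉ τ) : faceExp τ v = 0 := by
  classical
  rw [faceExp, Finsupp.finsetSum_apply]
  refine Finset.sum_eq_zero fun u hu => ?_
  rw [Finsupp.single_apply, if_neg]
  rintro rfl
  exact h hu

theorem faceExp_apply_of_mem {v : σ} {τ : Finset σ} (h : v ∈ τ) : faceExp τ v = 1 := by
  classical
  rw [← Finset.insert_erase h, faceExp_insert (Finset.notMem_erase v τ), Finsupp.add_apply,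
    faceExp_apply_of_notMem (Finset.notMem_erase v τ), Finsupp.single_eq_same]

end Keep

/-! ### The Koszul complex -/

section Koszul

variable {K σ : Type*} [Field K] [LinearOrder σ]

/-- The sign of the face `insert v τ → τ` in the Koszul complex. -/
def koszulSign (v : σ) (τ : Finset σ) : ℤ := (-1) ^ (τ.filter (· < v)).card

theorem koszulSign_mul_self (v : σ) (τ : Finset σ) : koszulSign v τ * koszulSign v τ = 1 := by
  rw [koszulSign, ← mul_pow]; simp

theorem koszulSign_insert_of_lt {u v : σ} {τ : Finset σ} (hu : u ∉ τ) (h : u < v) :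
    koszulSign v (insert u τ) = - koszulSign v τ := by
  rw [koszulSign, koszulSign, Finset.filter_insert, if_pos h, Finset.card_insert_of_notMem
    (by simp [hu]), pow_succ]
  simp

theorem koszulSign_insert_of_gt {u v : σ} {τ : Finset σ} (h : v < u) :
    koszulSign v (insert u τ) = koszulSign v τ := by
  rw [koszulSign, koszulSign, Finset.filter_insert, if_neg h.not_gt]

theorem koszulSign_anticomm {u v : σ} {τ : Finset σ} (huv : u ≠ v) (hu : u ∉ τ) (hv : v ∉ τ) :
    koszulSign u τ * koszulSign v (insert u τ) = -(koszulSign v τ * koszulSign u (insert v τ)) := by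
  rcases lt_or_gt_of_ne huv with h | h
  · rw [koszulSign_insert_of_lt hu h, koszulSign_insert_of_gt h]; ring
  · rw [koszulSign_insert_of_lt hv h, koszulSign_insert_of_gt h]; ring

theorem koszulSign_anticomm' {u v : σ} {τ : Finset σ} (huv : u ≠ v) (hu : u ∉ τ) (hv : v ∉ τ) :
    koszulSign u (insert v τ) * koszulSign v (insert u τ) = -(koszulSign v τ * koszulSign u τ) := by
  rcases lt_or_gt_of_ne huv with h | h
  · rw [koszulSign_insert_of_lt hu h, koszulSign_insert_of_gt h]; ring
  · rw [koszulSign_insert_of_lt hv h, koszulSign_insert_of_gt h]; ring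

variable [Fintype σ]

/-- The differential of the Koszul complex of the variables with coefficients in `M`. -/
def koszulD {M : Type*} [AddCommGroup M] [Module (MvPolynomial σ K) M] :
    (Finset σ → M) →ₗ[MvPolynomial σ K] (Finset σ → M) where
  toFun f τ := ∑ v ∈ τᶜ, koszulSign v τ • (X v : MvPolynomial σ K) • f (insert v τ)
  map_add' f g := by
    ext τ
    simp [smul_add, Finset.sum_add_distrib]
  map_smul' c f := by
    ext τ
    simp only [Pi.smul_apply, RingHom.id_apply, Finset.smul_sum]
    refine Finset.sum_congr rfl fun v _ => ?_
    rw [smul_comm c (koszulSign v τ), smul_comm c (X v : MvPolynomial σ K)]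

variable {M N : Type*} [AddCommGroup M] [Module (MvPolynomial σ K) M]
  [AddCommGroup N] [Module (MvPolynomial σ K) N]

theorem koszulD_apply (f : Finset σ → M) (τ : Finset σ) :
    koszulD (K := K) f τ =
      ∑ v ∈ τᶜ, koszulSign v τ • (X v : MvPolynomial σ K) • f (insert v τ) := rfl

theorem koszulD_comp (g : M →ₗ[MvPolynomial σ K] N) (f : Finset σ → M) :
    koszulD (K := K) (fun τ => g (f τ)) = fun τ => g (koszulD (K := K) f τ) := by
  ext τ
  simp [koszulD_apply, map_sum, map_zsmul]

/-- Removing `u` and `v` in the two possible orders gives opposite signs, so swapping the pair is a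
cancelling involution. -/
theorem koszulD_koszulD (f : Finset σ → M) : koszulD (K := K) (koszulD (K := K) f) = 0 := by
  ext τ
  simp only [koszulD_apply, Finset.smul_sum, Pi.zero_apply]
  rw [Finset.sum_sigma']
  refine Finset.sum_involution (fun x _ => ⟨x.2, x.1⟩) ?_ ?_ ?_ ?_
  · rintro ⟨v, u⟩ h
    simp only [Finset.mem_sigma, Finset.mem_compl, Finset.mem_insert, not_or] at h
    obtain ⟨hv, huv, hu⟩ := h
    dsimp only
    rw [Finset.insert_comm v u τ, smul_comm (X v : MvPolynomial σ K) (koszulSign u (insert v τ)),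
      smul_comm (X u : MvPolynomial σ K) (koszulSign v (insert u τ)), smul_smul (koszulSign v τ),
      smul_smul (koszulSign u τ),
      smul_comm (X v : MvPolynomial σ K) (X u : MvPolynomial σ K), ← add_smul,
      koszulSign_anticomm huv hu hv]
    simp
  · rintro ⟨v, u⟩ h _ h2
    simp only [Finset.mem_sigma, Finset.mem_compl, Finset.mem_insert, not_or] at h
    simp only [Sigma.mk.injEq, heq_eq_eq] at h2
    exact h.2.1 h2.1
  · rintro ⟨v, u⟩ h
    simp only [Finset.mem_sigma, Finset.mem_compl, Finset.mem_insert, not_or] at h ⊢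
    exact ⟨h.2.2, fun h' => h.2.1 h'.symm, h.1⟩
  · rintro ⟨v, u⟩ _
    rfl

/-- The component of multidegree `b` of a Koszul chain. -/
def multiComp (b : σ →₀ ℕ) (f : Finset σ → MvPolynomial σ K) : Finset σ → MvPolynomial σ K :=
  fun τ => keep (fun m => m + faceExp τ = b) (f τ)

/-- The differential trades the element `v` of a face for the factor `X v`, so `m + faceExp τ` is
preserved. -/
theorem koszulD_multiComp (b : σ →₀ ℕ) (f : Finset σ → MvPolynomial σ K) :
    koszulD (K := K) (multiComp b f) = multiComp b (koszulD (K := K) f) := by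
  ext1 τ
  rw [multiComp, koszulD_apply, koszulD_apply, keep_sum]
  refine Finset.sum_congr rfl fun v hv => ?_
  rw [Finset.mem_compl] at hv
  rw [keep_zsmul, smul_eq_mul, smul_eq_mul, multiComp,
    keep_mul (Q := fun m => m + faceExp (insert v τ) = b)]
  intro n hn m
  rw [support_X, Finset.mem_singleton] at hn
  rw [hn, faceExp_insert hv, add_comm (Finsupp.single v 1) m, add_assoc]

open Classical in
theorem sum_multiComp (f : Finset σ → MvPolynomial σ K) :
    ∑ b ∈ Finset.univ.biUnion (fun τ => (f τ).support.image (· + faceExp τ)), multiComp b f = f := by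
  ext τ m
  rw [Finset.sum_apply, coeff_sum]
  simp only [multiComp, coeff_keep]
  rw [Finset.sum_ite_eq, ite_eq_left_iff]
  intro h
  by_contra h'
  refine h (Finset.mem_biUnion.2 ⟨τ, Finset.mem_univ _, Finset.mem_image.2 ⟨m, ?_, rfl⟩⟩)
  exact mem_support_iff.2 fun h'' => h' h''.symm

/-- This is the contracting homotopy of a cone with apex `v`: divide by `X v` and add `v` to the
face. Keeping the quotient `f'` explicit lets the support of the bounding chain be controlled later.
-/
theorem koszulD_cone {v : σ} {f f' : Finset σ → MvPolynomial σ K} (hf : koszulD (K := K) f = 0)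
    (hf' : ∀ τ, v ∉ τ → f τ = X v * f' τ) :
    koszulD (K := K)
      (fun τ => if v ∈ τ then koszulSign v (τ.erase v) • f' (τ.erase v) else 0) = f := by
  ext1 τ
  rw [koszulD_apply]
  by_cases hv : v ∈ τ
  · obtain ⟨ρ, hρ, rfl⟩ : ∃ ρ, v ∉ ρ ∧ τ = insert v ρ :=
      ⟨τ.erase v, Finset.notMem_erase v τ, (Finset.insert_erase hv).symm⟩
    -- Divisibility is only assumed on faces avoiding `v`. For a face `insert v ρ`, the cycle
    -- condition at `ρ`, after cancelling `X v`, expresses `f (insert v ρ)` through the quotients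
    -- `f'`.
    have h0 := congrFun hf ρ
    rw [koszulD_apply, Pi.zero_apply, ← Finset.add_sum_erase _ _ (Finset.mem_compl.2 hρ),
      ← Finset.compl_insert] at h0
    have h1 : ∑ u ∈ (insert v ρ)ᶜ, koszulSign u ρ • (X u : MvPolynomial σ K) • f (insert u ρ) =
        X v * ∑ u ∈ (insert v ρ)ᶜ, koszulSign u ρ • (X u * f' (insert u ρ)) := by
      rw [Finset.mul_sum]
      refine Finset.sum_congr rfl fun u hu => ?_
      rw [Finset.mem_compl, Finset.mem_insert, not_or] at hu
      rw [hf' (insert u ρ) (by simp [hρ, Ne.symm hu.1]), mul_smul_comm, smul_eq_mul]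
      congr 1
      ring
    rw [h1, smul_eq_mul, ← mul_smul_comm, ← mul_add] at h0
    have h2 := (mul_eq_zero.1 h0).resolve_left (X_ne_zero v)
    have h3 : f (insert v ρ) =
        -(koszulSign v ρ • ∑ u ∈ (insert v ρ)ᶜ, koszulSign u ρ • (X u * f' (insert u ρ))) := by
      have := congrArg (koszulSign v ρ • ·) h2
      simp only [smul_add, smul_smul, koszulSign_mul_self, one_smul, smul_zero] at this
      exact eq_neg_of_add_eq_zero_left this
    rw [h3, Finset.smul_sum, ← Finset.sum_neg_distrib]
    refine Finset.sum_congr rfl fun u hu => ?_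
    rw [Finset.mem_compl, Finset.mem_insert, not_or] at hu
    have he : (insert u (insert v ρ)).erase v = insert u ρ := by
      rw [Finset.insert_comm, Finset.erase_insert]
      simp [hρ, Ne.symm hu.1]
    rw [if_pos (by simp), he, smul_eq_mul, mul_smul_comm, smul_smul, smul_smul,
      koszulSign_anticomm' hu.1 hu.2 hρ, neg_smul]
  · rw [Finset.sum_eq_single_of_mem v (Finset.mem_compl.2 hv)]
    · rw [if_pos (Finset.mem_insert_self v τ), Finset.erase_insert hv, smul_eq_mul, mul_smul_comm,
        smul_smul, koszulSign_mul_self, one_smul, hf' τ hv]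
    · intro u _ huv
      rw [if_neg (by simp [hv, Ne.symm huv]), smul_zero, smul_zero]

/-- A Koszul cycle is the boundary of a chain with support in `U` if, for every multidegree
occurring in it, there is a variable by which all terms not involving it can be divided within
`U`. -/
theorem exists_koszulD_eq {U : Set (σ →₀ ℕ)} {f : Finset σ → MvPolynomial σ K}
    (hf : koszulD (K := K) f = 0)
    (hgood : ∀ τ m, coeff m (f τ) ≠ 0 → ∃ v, (m + faceExp τ) v ≠ 0 ∧ ∀ ρ n,
      n + Finsupp.single v 1 + faceExp ρ = m + faceExp τ →
        coeff (n + Finsupp.single v 1) (f ρ) ≠ 0 → v ∉ ρ → n ∈ U) :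
    ∃ g : Finset σ → MvPolynomial σ K, koszulD (K := K) g = f ∧
      ∀ τ m, coeff m (g τ) ≠ 0 → m ∈ U ∧
        ∃ ρ n, coeff n (f ρ) ≠ 0 ∧ n + faceExp ρ = m + faceExp τ := by
  classical
  set B := Finset.univ.biUnion (fun τ => (f τ).support.image (· + faceExp τ)) with hB
  have key : ∀ b ∈ B, ∃ g : Finset σ → MvPolynomial σ K, koszulD (K := K) g = multiComp b f ∧
      ∀ τ m, coeff m (g τ) ≠ 0 → m ∈ U ∧
        ∃ ρ n, coeff n (f ρ) ≠ 0 ∧ n + faceExp ρ = m + faceExp τ := by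
    intro b hb
    simp only [hB, Finset.mem_biUnion, Finset.mem_image, Finset.mem_univ, true_and] at hb
    obtain ⟨τ₀, m₀, hm₀, rfl⟩ := hb
    obtain ⟨v, hv, hU⟩ := hgood τ₀ m₀ (mem_support_iff.1 hm₀)
    set b := m₀ + faceExp τ₀
    have hdiv : ∀ τ, ∃ q, v ∉ τ → multiComp b f τ = X v * q := by
      intro τ
      by_cases hvτ : v ∈ τ
      · exact ⟨0, fun h => absurd hvτ h⟩
      · obtain ⟨q, hq⟩ := exists_eq_X_mul (v := v) (p := multiComp b f τ) (by
          intro m hm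
          have h1 := (coeff_keep_ne_zero hm).1
          rw [← h1, Finsupp.add_apply, faceExp_apply_of_notMem hvτ] at hv
          exact hv)
        exact ⟨q, fun _ => hq⟩
    choose f' hf' using hdiv
    refine ⟨_, koszulD_cone (v := v) (f := multiComp b f) (f' := f') ?_ hf', ?_⟩
    · rw [koszulD_multiComp, hf]
      ext1 τ
      exact keep_zero _
    · intro τ m hm
      by_cases hvτ : v ∈ τ
      · rw [if_pos hvτ, coeff_smul] at hm
        have h1 : coeff m (f' (τ.erase v)) ≠ 0 := fun h => hm (by rw [h, smul_zero])
        -- A coefficient of the quotient at `m` is a coefficient of `f` at `m + single v 1` on a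
        -- face avoiding `v`, exactly the case covered by `hgood`.
        rw [← coeff_mul_X _ v, mul_comm, ← hf' _ (Finset.notMem_erase v τ)] at h1
        obtain ⟨h2, h3⟩ := coeff_keep_ne_zero h1
        have h4 : m + Finsupp.single v 1 + faceExp (τ.erase v) = m + faceExp τ := by
          rw [add_assoc, ← faceExp_insert (Finset.notMem_erase v τ), Finset.insert_erase hvτ]
        exact ⟨hU _ _ h2 h3 (Finset.notMem_erase v τ), _, _, h3, h4⟩
      · rw [if_neg hvτ] at hm
        simp at hm
  choose! g hg1 hg2 using key
  refine ⟨∑ b ∈ B, g b, ?_, ?_⟩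
  · rw [map_sum, Finset.sum_congr rfl hg1, sum_multiComp]
  · intro τ m hm
    rw [Finset.sum_apply, coeff_sum] at hm
    obtain ⟨b, hb, hb'⟩ := Finset.exists_ne_zero_of_sum_ne_zero hm
    exact hg2 b hb τ m hb'

end Koszul

/-! ### Koszul chains with coefficients in a minimal free resolution -/

section Chase

variable {K σ : Type*} [Field K]

/-- Koszul chains of total degree `D` with coefficients in a graded free module whose basis
elements have degrees `sh`. -/
def IsHomogeneousChain {ι : Type*} (sh : ι → ℕ) (D : ℕ)
    (z : Finset σ → ι → MvPolynomial σ K) : Prop :=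
  ∀ τ a m, coeff m (z τ a) ≠ 0 → m.degree + τ.card + sh a = D

theorem exists_coeff_mul_ne_zero {p q : MvPolynomial σ K} {m : σ →₀ ℕ} (h : coeff m (p * q) ≠ 0) :
    ∃ m₁ m₂, m₁ + m₂ = m ∧ coeff m₁ p ≠ 0 ∧ coeff m₂ q ≠ 0 := by
  classical
  rw [coeff_mul] at h
  obtain ⟨x, hx, hx'⟩ := Finset.exists_ne_zero_of_sum_ne_zero h
  exact ⟨x.1, x.2, Finset.HasAntidiagonal.mem_antidiagonal.1 hx, left_ne_zero_of_mul hx',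
    right_ne_zero_of_mul hx'⟩

variable {I : Ideal (MvPolynomial σ K)} (F : MinimalGradedFreeResolution I)

namespace MinimalGradedFreeResolution

/-- The augmentation of a resolution as a linear map. -/
abbrev aug : (Fin (F.rank 0) → MvPolynomial σ K) →ₗ[MvPolynomial σ K] MvPolynomial σ K :=
  Fintype.linearCombination (MvPolynomial σ K) F.gen

/-- The differential of a resolution as a linear map. -/
abbrev diff (q : ℕ) : (Fin (F.rank (q + 1)) → MvPolynomial σ K) →ₗ[MvPolynomial σ K]
    (Fin (F.rank q) → MvPolynomial σ K) :=
  (F.d q).mulVecLin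

theorem coeff_zero_diff (q : ℕ) (x : Fin (F.rank (q + 1)) → MvPolynomial σ K) (b : Fin (F.rank q)) :
    coeff 0 (F.diff q x b) = 0 := by
  rw [← constantCoeff_eq, diff, Matrix.mulVecLin_apply, Matrix.mulVec, dotProduct, map_sum]
  exact Finset.sum_eq_zero fun a _ => by rw [map_mul, F.minimal, zero_mul]

theorem isHomogeneousChain_diff {q D : ℕ}
    {z : Finset σ → Fin (F.rank (q + 1)) → MvPolynomial σ K}
    (hz : IsHomogeneousChain (F.shift (q + 1)) D z) :
    IsHomogeneousChain (F.shift q) D (fun τ => F.diff q (z τ)) := by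
  intro τ b m hm
  dsimp only at hm
  rw [diff, Matrix.mulVecLin_apply, Matrix.mulVec, dotProduct, coeff_sum] at hm
  obtain ⟨a, _, ha⟩ := Finset.exists_ne_zero_of_sum_ne_zero hm
  obtain ⟨m₁, m₂, rfl, h₁, h₂⟩ := exists_coeff_mul_ne_zero ha
  have e₁ := F.d_homogeneous q b a m₁ (mem_support_iff.2 h₁)
  have e₂ := hz τ a m₂ h₂
  rw [map_add]
  omega

theorem degree_eq_of_coeff_aug_ne_zero {D : ℕ} {z : Finset σ → Fin (F.rank 0) → MvPolynomial σ K}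
    (hz : IsHomogeneousChain (F.shift 0) D z) {τ : Finset σ} {m : σ →₀ ℕ}
    (hm : coeff m (F.aug (z τ)) ≠ 0) : (m + faceExp τ).degree = D := by
  rw [aug, Fintype.linearCombination_apply, coeff_sum] at hm
  obtain ⟨a, _, ha⟩ := Finset.exists_ne_zero_of_sum_ne_zero hm
  obtain ⟨m₁, m₂, rfl, h₁, h₂⟩ := exists_coeff_mul_ne_zero ha
  have e₁ := F.gen_homogeneous a h₂
  have e₂ := hz τ a m₁ h₁
  replace e₁ : m₂.degree = F.shift 0 a := by rw [Finsupp.degree_eq_weight_one]; exact e₁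
  rw [map_add, map_add, degree_faceExp]
  omega

theorem aug_mem (x : Fin (F.rank 0) → MvPolynomial σ K) : F.aug x ∈ I := by
  have : F.aug x ∈ LinearMap.range F.aug := ⟨x, rfl⟩
  rwa [F.range_gen] at this

/-- Every minimal monomial gives a basis element of `F_0`. -/
theorem exists_shift_zero_eq {U : Set (σ →₀ ℕ)}
    (hI : ∀ p, p ∈ I ↔ ∀ m, coeff m p ≠ 0 → m ∈ U) {b : σ →₀ ℕ} (hb : Minimal (· ∈ U) b) :
    ∃ a, F.shift 0 a = b.degree := by
  classical
  have h1 : monomial b (1 : K) ∈ LinearMap.range F.aug := by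
    rw [F.range_gen, hI]
    intro m hm
    rw [coeff_monomial] at hm
    have : b = m := by
      by_contra h
      exact hm (if_neg h)
    rw [← this]
    exact hb.1
  obtain ⟨x, hx⟩ := h1
  have h2 : coeff b (F.aug x) ≠ 0 := by rw [hx, coeff_monomial, if_pos rfl]; exact one_ne_zero
  rw [aug, Fintype.linearCombination_apply, coeff_sum] at h2
  obtain ⟨a, _, ha⟩ := Finset.exists_ne_zero_of_sum_ne_zero h2
  obtain ⟨m₁, m₂, he, h₁, h₂⟩ := exists_coeff_mul_ne_zero ha
  have hg : F.gen a ∈ I := by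
    have := F.aug_mem (Pi.single a 1)
    rwa [aug, Fintype.linearCombination_apply_single, one_smul] at this
  have hm₂ : m₂ = b := by
    have hle : m₂ ≤ b := by rw [← he]; exact le_add_self
    exact le_antisymm hle (hb.2 ((hI _).1 hg _ h₂) hle)
  have e₁ := F.gen_homogeneous a h₂
  replace e₁ : m₂.degree = F.shift 0 a := by rw [Finsupp.degree_eq_weight_one]; exact e₁
  exact ⟨a, by rw [← e₁, hm₂]⟩

/-- The Koszul chain given by a basis element. -/
def basisChain [DecidableEq σ] {q : ℕ} (a : Fin (F.rank q)) : Finset σ → Fin (F.rank q) → MvPolynomial σ K :=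
  Pi.single ∅ (Pi.single a 1)

theorem isHomogeneousChain_basisChain [DecidableEq σ] {q : ℕ} (a : Fin (F.rank q)) :
    IsHomogeneousChain (F.shift q) (F.shift q a) (F.basisChain a) := by
  intro τ b m hm
  by_cases hτ : τ = ∅
  · subst hτ
    rw [basisChain, Pi.single_eq_same] at hm
    by_cases hb : b = a
    · subst hb
      rw [Pi.single_eq_same, coeff_one] at hm
      have : m = 0 := by
        by_contra h
        exact hm (if_neg (Ne.symm h))
      simp [this]
    · rw [Pi.single_eq_of_ne hb] at hm
      simp at hm
  · rw [basisChain, Pi.single_eq_of_ne hτ] at hm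
    simp at hm

end MinimalGradedFreeResolution

variable [LinearOrder σ] [Fintype σ]

/-- The Koszul complex over the polynomial ring is exact away from multidegree `0`: every variable
occurring in the multidegree is a cone apex. The only term of multidegree `0` is the constant one on
the empty face, which `h0` excludes. -/
theorem exists_koszulD_eq_of_free {ι : Type*} {sh : ι → ℕ} {D : ℕ}
    {z : Finset σ → ι → MvPolynomial σ K} (hz : IsHomogeneousChain sh D z)
    (hd : koszulD (K := K) z = 0) (h0 : ∀ a, coeff 0 (z ∅ a) = 0) :
    ∃ z', IsHomogeneousChain sh D z' ∧ koszulD (K := K) z' = z := by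
  have key : ∀ a, ∃ g : Finset σ → MvPolynomial σ K,
      koszulD (K := K) g = (fun τ => z τ a) ∧
      ∀ τ m, coeff m (g τ) ≠ 0 → m ∈ Set.univ ∧
        ∃ ρ n, coeff n (z ρ a) ≠ 0 ∧ n + faceExp ρ = m + faceExp τ := by
    intro a
    refine exists_koszulD_eq (U := Set.univ) (f := fun τ => z τ a) ?_ ?_
    · have := koszulD_comp (K := K) (LinearMap.proj (R := MvPolynomial σ K)
        (φ := fun _ : ι => MvPolynomial σ K) a) z
      simp only [LinearMap.proj_apply] at this
      rw [this, hd]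
      rfl
    · intro τ m hm
      have hne : m + faceExp τ ≠ 0 := by
        intro h
        rw [add_eq_zero] at h
        have hτ : τ = ∅ := by rw [← Finset.card_eq_zero, ← degree_faceExp, h.2, map_zero]
        rw [h.1, hτ] at hm
        exact hm (h0 a)
      obtain ⟨v, hv⟩ := Finsupp.ne_iff.1 hne
      exact ⟨v, hv, fun _ _ _ _ _ => Set.mem_univ _⟩
  choose g hg1 hg2 using key
  refine ⟨fun τ a => g a τ, ?_, ?_⟩
  · intro τ a m hm
    obtain ⟨-, ρ, n, hn, he⟩ := hg2 a τ m hm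
    have := congrArg Finsupp.degree he
    rw [map_add, map_add, degree_faceExp, degree_faceExp] at this
    rw [← hz ρ a n hn, this]
  · ext1 τ
    ext1 a
    have := koszulD_comp (K := K) (LinearMap.proj (R := MvPolynomial σ K)
        (φ := fun _ : ι => MvPolynomial σ K) a) (fun τ a => g a τ)
    simp only [LinearMap.proj_apply] at this
    rw [← congrFun this τ, hg1]

namespace MinimalGradedFreeResolution

/-- One step of dimension shifting. The image `d z` is a Koszul cycle in a free module without
constant terms, so it is the boundary of some `z'`. If `z' = ∂w + dt`, then `z - ∂t` is killed by
`d` up to sign-free commutation of `d` and `∂`, and exactness finishes. -/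
theorem exists_lift_chain {q D : ℕ} {z : Finset σ → Fin (F.rank (q + 1)) → MvPolynomial σ K}
    (hz : IsHomogeneousChain (F.shift (q + 1)) D z)
    (hd : ∀ τ, F.diff q (koszulD (K := K) z τ) = 0) :
    ∃ z', IsHomogeneousChain (F.shift q) D z' ∧
      koszulD (K := K) z' = (fun τ => F.diff q (z τ)) ∧
      ((∃ (w : Finset σ → Fin (F.rank q) → MvPolynomial σ K)
        (t : Finset σ → Fin (F.rank (q + 1)) → MvPolynomial σ K), z' = koszulD (K := K) w + fun τ => F.diff q (t τ)) →
        ∃ (w : Finset σ → Fin (F.rank (q + 1)) → MvPolynomial σ K)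
        (t : Finset σ → Fin (F.rank (q + 1 + 1)) → MvPolynomial σ K), z = koszulD (K := K) w + fun τ => F.diff (q + 1) (t τ)) := by
  obtain ⟨z', h1, h2⟩ := exists_koszulD_eq_of_free (F.isHomogeneousChain_diff hz)
    (by rw [koszulD_comp]; exact funext hd) (fun a => F.coeff_zero_diff q _ a)
  refine ⟨z', h1, h2, ?_⟩
  rintro ⟨w, t, rfl⟩
  rw [map_add, koszulD_koszulD, zero_add, koszulD_comp] at h2
  have h3 : ∀ τ, ∃ s, F.diff (q + 1) s = z τ - koszulD (K := K) t τ := by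
    intro τ
    refine (F.exact_succ q _).1 ?_
    have := congrFun h2 τ
    rw [map_sub, ← this, sub_self]
  choose s hs using h3
  refine ⟨t, s, funext fun τ => ?_⟩
  rw [Pi.add_apply, hs, add_sub_cancel]

theorem exists_eq_koszulD_add_diff {D : ℕ}
    (base : ∀ z, IsHomogeneousChain (F.shift 0) D z →
      (∀ τ, F.aug (koszulD (K := K) z τ) = 0) →
      ∃ (w : Finset σ → Fin (F.rank 0) → MvPolynomial σ K)
        (t : Finset σ → Fin (F.rank 1) → MvPolynomial σ K), z = koszulD (K := K) w + fun τ => F.diff 0 (t τ)) (q : ℕ) :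
    ∀ z, IsHomogeneousChain (F.shift (q + 1)) D z →
      (∀ τ, F.diff q (koszulD (K := K) z τ) = 0) →
      ∃ (w : Finset σ → Fin (F.rank (q + 1)) → MvPolynomial σ K)
        (t : Finset σ → Fin (F.rank (q + 1 + 1)) → MvPolynomial σ K), z = koszulD (K := K) w + fun τ => F.diff (q + 1) (t τ) := by
  induction q with
  | zero =>
    intro z hz hd
    obtain ⟨z', h1, h2, h3⟩ := F.exists_lift_chain hz hd
    refine h3 (base z' h1 fun τ => ?_)
    rw [h2]
    exact (F.exact_zero _).2 ⟨_, rfl⟩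
  | succ q ih =>
    intro z hz hd
    obtain ⟨z', h1, h2, h3⟩ := F.exists_lift_chain hz hd
    refine h3 (ih z' h1 fun τ => ?_)
    rw [h2]
    exact (F.exact_succ q _).2 ⟨_, rfl⟩

/-- The bottom of the chase: the augmentation of `z` is a Koszul cycle over `I`. The support
condition makes it bound within `I`, so the bounding chain lifts to `F_0`, and exactness there
absorbs the difference. -/
theorem exists_eq_koszulD_add_diff_zero {U : Set (σ →₀ ℕ)}
    (hI : ∀ p, p ∈ I ↔ ∀ m, coeff m p ≠ 0 → m ∈ U)
    {z : Finset σ → Fin (F.rank 0) → MvPolynomial σ K}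
    (hd : ∀ τ, F.aug (koszulD (K := K) z τ) = 0)
    (hgood : ∀ τ m, coeff m (F.aug (z τ)) ≠ 0 → ∃ v, (m + faceExp τ) v ≠ 0 ∧ ∀ ρ n,
      n + Finsupp.single v 1 + faceExp ρ = m + faceExp τ →
        coeff (n + Finsupp.single v 1) (F.aug (z ρ)) ≠ 0 → v ∉ ρ → n ∈ U) :
    ∃ (w : Finset σ → Fin (F.rank 0) → MvPolynomial σ K)
        (t : Finset σ → Fin (F.rank 1) → MvPolynomial σ K), z = koszulD (K := K) w + fun τ => F.diff 0 (t τ) := by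
  obtain ⟨g, hg, hgU⟩ := exists_koszulD_eq (U := U) (f := fun τ => F.aug (z τ))
    (by rw [koszulD_comp]; exact funext hd) hgood
  have hr : ∀ τ, ∃ w, F.aug w = g τ := by
    intro τ
    have : g τ ∈ LinearMap.range F.aug := by
      rw [F.range_gen, hI]
      exact fun m hm => (hgU τ m hm).1
    exact this
  choose w hw using hr
  have h3 : ∀ τ, ∃ s, F.diff 0 s = z τ - koszulD (K := K) w τ := by
    intro τ
    refine (F.exact_zero _).1 ?_
    have := congrFun (koszulD_comp (K := K) F.aug w) τ
    rw [map_sub, ← this]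
    simp only [hw]
    rw [hg, sub_self]
  choose s hs using h3
  exact ⟨w, s, funext fun τ => by rw [Pi.add_apply, hs, add_sub_cancel]⟩

theorem koszulD_basisChain {q : ℕ} (a : Fin (F.rank q)) :
    koszulD (K := K) (F.basisChain a) = 0 := by
  ext1 τ
  rw [koszulD_apply]
  refine Finset.sum_eq_zero fun v _ => ?_
  rw [basisChain, Pi.single_eq_of_ne (Finset.insert_ne_empty v τ), smul_zero, smul_zero]

/-- The constant term at the empty face separates them: it is `1` for a basis element, while Koszul
boundaries and, by minimality, images of the differential have none. -/
theorem basisChain_ne {q : ℕ} (a : Fin (F.rank q))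
    (w : Finset σ → Fin (F.rank q) → MvPolynomial σ K)
    (t : Finset σ → Fin (F.rank (q + 1)) → MvPolynomial σ K) :
    F.basisChain a ≠ koszulD (K := K) w + fun τ => F.diff q (t τ) := by
  intro h
  have h1 := congrArg (coeff 0) (congrFun (congrFun h ∅) a)
  rw [basisChain, Pi.single_eq_same, Pi.single_eq_same, Pi.add_apply, Pi.add_apply, coeff_add,
    coeff_zero_diff, koszulD_apply, Finset.sum_apply, coeff_sum, Finset.sum_eq_zero] at h1
  · simp at h1
  · intro v _
    rw [Pi.smul_apply, coeff_smul, Pi.smul_apply, smul_eq_mul, ← constantCoeff_eq, map_mul,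
      constantCoeff_X, zero_mul, smul_zero]

/-- The degree of a basis element of `F_{i+1}` is the degree of a multidegree whose Koszul complex
is not a cone. -/
theorem exists_multidegree_succ {U : Set (σ →₀ ℕ)}
    (hI : ∀ p, p ∈ I ↔ ∀ m, coeff m p ≠ 0 → m ∈ U) (i : ℕ) (a : Fin (F.rank (i + 1))) :
    ∃ b : σ →₀ ℕ, b.degree = F.shift (i + 1) a ∧ (∃ ρ, ∃ n ∈ U, n + faceExp ρ = b) ∧
      ∀ v, b v ≠ 0 → ∃ ρ n, n + Finsupp.single v 1 + faceExp ρ = b ∧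
        n + Finsupp.single v 1 ∈ U ∧ v ∉ ρ ∧ n ∉ U := by
  -- Otherwise every relevant multidegree of this total degree has a cone apex, and the chase would
  -- make the basis chain trivial.
  by_contra! hcon
  obtain ⟨w, t, h⟩ := F.exists_eq_koszulD_add_diff (D := F.shift (i + 1) a) (by
    intro z hz hd
    refine F.exists_eq_koszulD_add_diff_zero hI hd ?_
    intro τ m hm
    obtain ⟨v, hv, h⟩ := hcon (m + faceExp τ) (F.degree_eq_of_coeff_aug_ne_zero hz hm)
      ⟨τ, m, (hI _).1 (F.aug_mem _) m hm, rfl⟩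
    exact ⟨v, hv, fun ρ n he hn hvρ => h ρ n he ((hI _).1 (F.aug_mem _) _ hn) hvρ⟩) i
    (F.basisChain a) (F.isHomogeneousChain_basisChain a)
    (fun τ => by rw [koszulD_basisChain, Pi.zero_apply, map_zero])
  exact F.basisChain_ne a w t h

/-- The degree of a basis element of `F_0` is the degree of a minimal monomial. -/
theorem exists_multidegree_zero {U : Set (σ →₀ ℕ)}
    (hI : ∀ p, p ∈ I ↔ ∀ m, coeff m p ≠ 0 → m ∈ U) (a : Fin (F.rank 0)) :
    ∃ b ∈ U, b.degree = F.shift 0 a ∧ ∀ v n, n + Finsupp.single v 1 = b → n ∉ U := by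
  by_contra! hcon
  obtain ⟨w, t, h⟩ := F.exists_eq_koszulD_add_diff_zero hI (z := F.basisChain a)
    (fun τ => by rw [koszulD_basisChain, Pi.zero_apply, map_zero]) (by
    -- The chain lives on the empty face, so its multidegrees are exponents in `U`, and the apex
    -- condition reduces to lowering such an exponent once without leaving `U`.
    have hne : ∀ τ m, coeff m (F.aug (F.basisChain a τ)) ≠ 0 → τ = ∅ := by
      intro τ m hm
      by_contra hτ
      rw [basisChain, Pi.single_eq_of_ne hτ, map_zero] at hm
      simp at hm
    intro τ m hm
    have hdeg := F.degree_eq_of_coeff_aug_ne_zero (F.isHomogeneousChain_basisChain a) hm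
    obtain rfl := hne τ m hm
    have h0 : m + faceExp (∅ : Finset σ) = m := by simp [faceExp]
    rw [h0] at hdeg ⊢
    obtain ⟨v, n, rfl, hn⟩ := hcon m ((hI _).1 (F.aug_mem _) m hm) hdeg
    refine ⟨v, by simp, fun ρ n' he hn' _ => ?_⟩
    obtain rfl := hne ρ _ hn'
    have h1 : n' + Finsupp.single v 1 + faceExp (∅ : Finset σ) = n' + Finsupp.single v 1 := by
      simp [faceExp]
    rw [h1] at he
    rwa [add_right_cancel he])
  exact F.basisChain_ne a w t h

end MinimalGradedFreeResolution

end Chase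

/-! ### The numerical estimates -/

section Numerical

variable {V : Type*} [Fintype V] {G : SimpleGraph V}

/-- Let `u` minimize `b`. Replacing the partner `w` by `u` gives `b v + b u ≤ k` for all `v`;
summing over the `n` vertices `v ≠ u` leaves room for the one remaining `b u` as soon as `n ≥ 1`. -/
theorem sum_le_of_forall_adj {b : V → ℕ} {k n : ℕ} (hn : Fintype.card V = n + 1)
    (h : ∀ v, b v ≠ 0 → ∃ w, G.Adj v w ∧ b v + b w = k) : ∑ v, b v ≤ k * n := by
  classical
  have : Nonempty V := Fintype.card_pos_iff.1 (by omega)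
  obtain ⟨u, -, hu⟩ := Finset.exists_min_image Finset.univ b Finset.univ_nonempty
  have hle : ∀ v, b v + b u ≤ k := by
    intro v
    by_cases hv : b v = 0
    · have := hu v (Finset.mem_univ v)
      omega
    · obtain ⟨w, -, hw⟩ := h v hv
      have := hu w (Finset.mem_univ w)
      omega
  have hcard : (Finset.univ.erase u).card = n := by
    rw [Finset.card_erase_of_mem (Finset.mem_univ u), Finset.card_univ, hn]; rfl
  have hsum : ∑ v ∈ Finset.univ.erase u, (b v + b u) ≤ n * k := by
    have := Finset.sum_le_card_nsmul (Finset.univ.erase u) _ k (fun v _ => hle v)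
    rwa [hcard, smul_eq_mul] at this
  rw [Finset.sum_add_distrib, Finset.sum_const, hcard, smul_eq_mul] at hsum
  rw [← Finset.add_sum_erase _ _ (Finset.mem_univ u)]
  rcases Nat.eq_zero_or_pos n with rfl | hpos
  · have hbu : b u = 0 := by
      by_contra hb
      obtain ⟨w, hw, -⟩ := h u hb
      have : Subsingleton V := Fintype.card_le_one_iff_subsingleton.1 (by omega)
      exact hw.ne (Subsingleton.elim _ _)
    omega
  · nlinarith [Nat.le_mul_of_pos_left (b u) hpos]

/-- If the minimum is `0`, every entry is at most `k`, since the exceptional case has `b w ≠ 0`. If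
the minimum is positive, summing `b v + b u ≤ k + 1` over `v ≠ u` loses `n`, and all but `1` of it
is regained from the `n - 1` surplus copies of `b u`. -/
theorem sum_le_of_forall_adj_or {b : V → ℕ} {k n : ℕ} (hn : Fintype.card V = n + 1)
    (h : ∀ v, b v ≠ 0 → ∃ w, G.Adj v w ∧ (b v + b w = k ∨ b v + b w = k + 1 ∧ b w ≠ 0)) :
    ∑ v, b v ≤ k * n + 1 := by
  classical
  have : Nonempty V := Fintype.card_pos_iff.1 (by omega)
  obtain ⟨u, -, hu⟩ := Finset.exists_min_image Finset.univ b Finset.univ_nonempty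
  have hcard : (Finset.univ.erase u).card = n := by
    rw [Finset.card_erase_of_mem (Finset.mem_univ u), Finset.card_univ, hn]; rfl
  rw [← Finset.add_sum_erase _ _ (Finset.mem_univ u)]
  by_cases hbu : b u = 0
  · have hle : ∀ v, b v ≤ k := by
      intro v
      by_cases hv : b v = 0
      · omega
      · obtain ⟨w, -, hw⟩ := h v hv
        omega
    have := Finset.sum_le_card_nsmul (Finset.univ.erase u) _ k (fun v _ => hle v)
    rw [hcard, smul_eq_mul] at this
    nlinarith
  · have hle : ∀ v, b v + b u ≤ k + 1 := by
      intro v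
      have hv := hu v (Finset.mem_univ v)
      obtain ⟨w, -, hw⟩ := h v (by omega)
      have := hu w (Finset.mem_univ w)
      omega
    have hsum := Finset.sum_le_card_nsmul (Finset.univ.erase u) _ (k + 1) (fun v _ => hle v)
    rw [Finset.sum_add_distrib, Finset.sum_const, hcard, smul_eq_mul, smul_eq_mul] at hsum
    obtain ⟨w, hw, -⟩ := h u hbu
    have hpos : 1 ≤ n := by
      have := Fintype.one_lt_card_iff.2 ⟨u, w, hw.ne⟩
      omega
    obtain ⟨p, hp⟩ := Nat.exists_eq_succ_of_ne_zero hbu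
    obtain ⟨r, rfl⟩ := Nat.exists_eq_add_of_le hpos
    rw [hp] at hsum ⊢
    simp only [Nat.succ_eq_add_one] at hsum ⊢
    -- With `n = 1 + r` and `b u = p + 1`, the slack in the bound is exactly `r * p`.
    nlinarith [Nat.zero_le (r * p)]

/-- The exponents of the monomials of the `k`-th symbolic power of the cover ideal. -/
def symbolicExps (G : SimpleGraph V) (k : ℕ) : Set (V →₀ ℕ) :=
  {m | ∀ v w, G.Adj v w → k ≤ m v + m w}

/-- Lowering the exponent at `v` by one can only violate the condition of an edge at `v`, and that
edge was tight before. -/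
theorem exists_adj_of_notMem_symbolicExps {k : ℕ} {n : V →₀ ℕ} {v : V}
    (h : n + Finsupp.single v 1 ∈ symbolicExps G k) (hn : n ∉ symbolicExps G k) :
    ∃ w, G.Adj v w ∧ n v + 1 + n w = k := by
  classical
  simp only [symbolicExps, Set.mem_ofPred_eq, not_forall, not_le] at hn
  obtain ⟨s, t, hst, hlt⟩ := hn
  have h1 := h s t hst
  simp only [Finsupp.add_apply, Finsupp.single_apply] at h1
  by_cases hs : v = s
  · subst hs
    refine ⟨t, hst, ?_⟩
    rw [if_pos rfl, if_neg hst.ne] at h1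
    omega
  · by_cases ht : v = t
    · subst ht
      refine ⟨s, hst.symm, ?_⟩
      rw [if_pos rfl, if_neg hs] at h1
      omega
    · rw [if_neg hs, if_neg ht] at h1
      omega

end Numerical

/-! ### Existence of minimal graded free resolutions -/

section Existence

variable {K σ : Type*} [Field K]

/-- The component of degree `D` of an element of a graded free module whose basis elements have
degrees `sh`. -/
def degComp {ι : Type*} (sh : ι → ℕ) (D : ℕ) (x : ι → MvPolynomial σ K) : ι → MvPolynomial σ K :=
  fun a => keep (fun m => m.degree + sh a = D) (x a)

/-- The homogeneous elements of degree `D` of a graded free module. -/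
def IsHomogeneousElement {ι : Type*} (sh : ι → ℕ) (D : ℕ) (x : ι → MvPolynomial σ K) : Prop :=
  ∀ a m, coeff m (x a) ≠ 0 → m.degree + sh a = D

theorem isHomogeneousElement_degComp {ι : Type*} (sh : ι → ℕ) (D : ℕ)
    (x : ι → MvPolynomial σ K) : IsHomogeneousElement sh D (degComp sh D x) :=
  fun _ _ hm => (coeff_keep_ne_zero hm).1

theorem sum_degComp {ι : Type*} [Fintype ι] (sh : ι → ℕ) (x : ι → MvPolynomial σ K) :
    ∑ D ∈ Finset.univ.biUnion (fun a => (x a).support.image (fun m => m.degree + sh a)),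
      degComp sh D x = x := by
  ext a m
  rw [Finset.sum_apply, coeff_sum]
  simp only [degComp, coeff_keep]
  rw [Finset.sum_ite_eq, ite_eq_left_iff]
  intro h
  by_contra h'
  refine h (Finset.mem_biUnion.2 ⟨a, Finset.mem_univ _, Finset.mem_image.2 ⟨m, ?_, rfl⟩⟩)
  exact mem_support_iff.2 fun h'' => h' h''.symm

theorem mulVec_degComp {ι κ : Type*} [Fintype κ] {sh : ι → ℕ} {sh' : κ → ℕ}
    {d : Matrix ι κ (MvPolynomial σ K)}
    (hd : ∀ b a, ∀ m ∈ (d b a).support, m.degree + sh b = sh' a) (D : ℕ)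
    (x : κ → MvPolynomial σ K) :
    d.mulVec (degComp sh' D x) = degComp sh D (d.mulVec x) := by
  ext1 b
  rw [degComp, Matrix.mulVec, Matrix.mulVec, dotProduct, dotProduct, keep_sum]
  refine Finset.sum_congr rfl fun a _ => (keep_mul ?_ _).symm
  intro n hn m
  have := hd b a n hn
  rw [map_add]
  omega

theorem linearCombination_row {r : ℕ} (d : Matrix (Fin 1) (Fin r) (MvPolynomial σ K))
    (x : Fin r → MvPolynomial σ K) :
    Fintype.linearCombination (MvPolynomial σ K) (fun a => d 0 a) x = d.mulVecLin x 0 := by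
  rw [Fintype.linearCombination_apply, Matrix.mulVecLin_apply, Matrix.mulVec, dotProduct]
  exact Finset.sum_congr rfl fun a _ => by rw [smul_eq_mul, mul_comm]

theorem linearCombination_row_eq_zero_iff {r : ℕ} (d : Matrix (Fin 1) (Fin r) (MvPolynomial σ K))
    (x : Fin r → MvPolynomial σ K) :
    Fintype.linearCombination (MvPolynomial σ K) (fun a => d 0 a) x = 0 ↔ d.mulVecLin x = 0 := by
  rw [linearCombination_row]
  refine ⟨fun h => funext fun b => ?_, fun h => by rw [h]; rfl⟩
  rw [Subsingleton.elim b 0, h]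
  rfl

theorem range_linearCombination_row {r : ℕ} {d : Matrix (Fin 1) (Fin r) (MvPolynomial σ K)}
    {I : Ideal (MvPolynomial σ K)}
    (h : LinearMap.range d.mulVecLin = Submodule.comap (LinearMap.proj 0) I) :
    LinearMap.range (Fintype.linearCombination (MvPolynomial σ K) (fun a => d 0 a)) = I := by
  ext p
  constructor
  · rintro ⟨x, rfl⟩
    rw [linearCombination_row]
    have : d.mulVecLin x ∈ LinearMap.range d.mulVecLin := ⟨x, rfl⟩
    rw [h] at this
    exact this
  · intro hp
    have : (fun _ => p) ∈ LinearMap.range d.mulVecLin := by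
      rw [h]
      exact hp
    obtain ⟨x, hx⟩ := this
    exact ⟨x, by rw [linearCombination_row, hx]⟩

variable [Finite σ]

/-- The span of the elements `g a` is `N`, and the `g a` are homogeneous of degrees `sh' a`. -/
def IsHomogeneousGenerators {n r : ℕ} (sh : Fin n → ℕ)
    (N : Submodule (MvPolynomial σ K) (Fin n → MvPolynomial σ K)) (sh' : Fin r → ℕ)
    (g : Fin r → Fin n → MvPolynomial σ K) : Prop :=
  (∀ a, IsHomogeneousElement sh (sh' a) (g a)) ∧ Submodule.span _ (Set.range g) = N

theorem exists_isHomogeneousGenerators {n : ℕ} {sh : Fin n → ℕ}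
    {N : Submodule (MvPolynomial σ K) (Fin n → MvPolynomial σ K)}
    (hN : ∀ D, ∀ x ∈ N, degComp sh D x ∈ N) :
    ∃ (r : ℕ) (sh' : Fin r → ℕ) (g : Fin r → Fin n → MvPolynomial σ K),
      IsHomogeneousGenerators sh N sh' g := by
  set T : Set (Fin n → MvPolynomial σ K) := {x | x ∈ N ∧ ∃ D, IsHomogeneousElement sh D x} with hT
  have hspan : Submodule.span (MvPolynomial σ K) T = N := by
    refine le_antisymm (Submodule.span_le.2 fun x hx => hx.1) fun x hx => ?_
    rw [← sum_degComp sh x]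
    exact Submodule.sum_mem _ fun D _ => Submodule.subset_span
      ⟨hN D x hx, D, isHomogeneousElement_degComp sh D x⟩
  have hfg : (Submodule.span (MvPolynomial σ K) T).FG := IsNoetherian.noetherian _
  rw [Submodule.fg_span_iff_fg_span_finset_subset] at hfg
  obtain ⟨T', hT', hs⟩ := hfg
  have hhom : ∀ x : T', ∃ D, IsHomogeneousElement sh D x.1 := fun x => (hT' x.2).2
  choose D hD using hhom
  refine ⟨T'.card, fun a => D (T'.equivFin.symm a), fun a => (T'.equivFin.symm a).1,
    fun a => hD _, ?_⟩
  rw [← hspan, hs]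
  congr 1
  ext x
  constructor
  · rintro ⟨a, rfl⟩
    exact (T'.equivFin.symm a).2
  · intro hx
    exact ⟨T'.equivFin ⟨x, hx⟩, by simp⟩

/-- Take the least number of homogeneous generators. A relation with a nonzero constant entry would
make one of them redundant. -/
theorem exists_minimal_generators {n : ℕ} {sh : Fin n → ℕ}
    {N : Submodule (MvPolynomial σ K) (Fin n → MvPolynomial σ K)}
    (hN : ∀ D, ∀ x ∈ N, degComp sh D x ∈ N) :
    ∃ (r : ℕ) (sh' : Fin r → ℕ) (d : Matrix (Fin n) (Fin r) (MvPolynomial σ K)),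
      LinearMap.range d.mulVecLin = N ∧
      (∀ b a, ∀ m ∈ (d b a).support, m.degree + sh b = sh' a) ∧
      ∀ x, d.mulVec x = 0 → ∀ a, constantCoeff (x a) = 0 := by
  classical
  have hex := exists_isHomogeneousGenerators hN
  obtain ⟨sh', g, hg, hspan⟩ := Nat.find_spec hex
  have hmin := fun r => Nat.find_min hex (m := r)
  generalize Nat.find hex = r at sh' g hg hspan hmin
  have hd : ∀ b a, ∀ m ∈ ((Matrix.of g).transpose b a).support, m.degree + sh b = sh' a :=
    fun b a m hm => hg a b m (mem_support_iff.1 hm)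
  refine ⟨r, sh', (Matrix.of g).transpose, ?_, hd, ?_⟩
  · rw [Matrix.range_mulVecLin]
    exact hspan
  · intro x hx a₀
    by_contra hc
    obtain _ | r := r
    · exact a₀.elim0
    refine hmin r (Nat.lt_succ_self r) ⟨fun a => sh' (a₀.succAbove a),
      fun a => g (a₀.succAbove a), fun a => hg _, ?_⟩
    -- The component of degree `sh' a₀` is again a relation, and its entry at `a₀` is a nonzero
    -- constant, so `g a₀` can be solved for.
    set y := degComp sh' (sh' a₀) x with hy
    have hdy : (Matrix.of g).transpose.mulVec y = 0 := by
      rw [hy, mulVec_degComp hd, hx]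
      ext1 b
      exact keep_zero _
    have hya : y a₀ = C (constantCoeff (x a₀)) := by
      ext m
      rw [hy, degComp, coeff_keep, coeff_C, constantCoeff_eq]
      by_cases hm : m = 0
      · subst hm; simp
      · rw [if_neg (Ne.symm hm), if_neg]
        rwa [add_eq_right, Finsupp.degree_eq_zero_iff]
    have hsum : ∑ a, y a • g a = 0 := by
      rw [← hdy]
      ext1 b
      rw [Finset.sum_apply, Matrix.mulVec, dotProduct]
      exact Finset.sum_congr rfl fun a _ => by
        rw [Pi.smul_apply, smul_eq_mul, mul_comm, Matrix.transpose_apply, Matrix.of_apply]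
    rw [Fin.sum_univ_succAbove _ a₀, hya] at hsum
    have hmem : g a₀ ∈ Submodule.span (MvPolynomial σ K)
        (Set.range fun a => g (a₀.succAbove a)) := by
      have h1 : C (σ := σ) (constantCoeff (x a₀)) • g a₀ ∈ Submodule.span (MvPolynomial σ K)
          (Set.range fun a => g (a₀.succAbove a)) := by
        rw [eq_neg_of_add_eq_zero_left hsum]
        exact Submodule.neg_mem _ (Submodule.sum_mem _ fun a _ =>
          Submodule.smul_mem _ _ (Submodule.subset_span ⟨a, rfl⟩))
      have h2 := Submodule.smul_mem _ (C (σ := σ) (constantCoeff (x a₀))⁻¹) h1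
      rwa [smul_smul, ← C_mul, inv_mul_cancel₀ hc, C_1, one_smul] at h2
    rw [← hspan]
    refine le_antisymm (Submodule.span_mono ?_) (Submodule.span_le.2 ?_)
    · rintro _ ⟨a, rfl⟩
      exact ⟨_, rfl⟩
    · rintro _ ⟨a, rfl⟩
      rcases Fin.eq_self_or_eq_succAbove a₀ a with rfl | ⟨a', rfl⟩
      · exact hmem
      · exact Submodule.subset_span ⟨a', rfl⟩

variable (K σ) in
/-- A graded submodule of a graded free module of finite rank. -/
structure GradedSubmodule where
  /-- the rank of the free module -/
  rank : ℕ
  /-- the degrees of the basis elements -/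
  shift : Fin rank → ℕ
  /-- the submodule -/
  carrier : Submodule (MvPolynomial σ K) (Fin rank → MvPolynomial σ K)
  /-- the submodule is graded -/
  graded : ∀ D, ∀ x ∈ carrier, degComp shift D x ∈ carrier

namespace GradedSubmodule

/-- The number of minimal generators. -/
def genRank (N : GradedSubmodule K σ) : ℕ := (exists_minimal_generators N.graded).choose

/-- The degrees of the minimal generators. -/
def genShift (N : GradedSubmodule K σ) : Fin N.genRank → ℕ :=
  (exists_minimal_generators N.graded).choose_spec.choose

/-- The matrix whose columns are minimal generators. -/
def genMatrix (N : GradedSubmodule K σ) :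
    Matrix (Fin N.rank) (Fin N.genRank) (MvPolynomial σ K) :=
  (exists_minimal_generators N.graded).choose_spec.choose_spec.choose

theorem range_genMatrix (N : GradedSubmodule K σ) :
    LinearMap.range N.genMatrix.mulVecLin = N.carrier :=
  (exists_minimal_generators N.graded).choose_spec.choose_spec.choose_spec.1

theorem genMatrix_homogeneous (N : GradedSubmodule K σ) :
    ∀ b a, ∀ m ∈ (N.genMatrix b a).support, m.degree + N.shift b = N.genShift a :=
  (exists_minimal_generators N.graded).choose_spec.choose_spec.choose_spec.2.1

theorem genMatrix_minimal (N : GradedSubmodule K σ) :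
    ∀ x, N.genMatrix.mulVec x = 0 → ∀ a, constantCoeff (x a) = 0 :=
  (exists_minimal_generators N.graded).choose_spec.choose_spec.choose_spec.2.2

/-- The first syzygy module. -/
def syzygy (N : GradedSubmodule K σ) : GradedSubmodule K σ where
  rank := N.genRank
  shift := N.genShift
  carrier := LinearMap.ker N.genMatrix.mulVecLin
  graded := by
    intro D x hx
    rw [LinearMap.mem_ker, Matrix.mulVecLin_apply] at hx ⊢
    rw [mulVec_degComp N.genMatrix_homogeneous, hx]
    ext1 b
    exact keep_zero _

/-- An ideal with homogeneous components, as a graded submodule. -/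
def ofIdeal (I : Ideal (MvPolynomial σ K))
    (hI : ∀ D, ∀ p ∈ I, keep (fun m => m.degree = D) p ∈ I) : GradedSubmodule K σ where
  rank := 1
  shift := fun _ => 0
  carrier := Submodule.comap (LinearMap.proj 0) I
  graded := fun D x hx => hI D (x 0) hx

/-- The iterated syzygy modules. -/
def iterSyzygy (N : GradedSubmodule K σ) : ℕ → GradedSubmodule K σ
  | 0 => N
  | i + 1 => (N.iterSyzygy i).syzygy

theorem genMatrix_syzygy_exact (N : GradedSubmodule K σ) :
    Function.Exact N.syzygy.genMatrix.mulVecLin N.genMatrix.mulVecLin := by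
  intro x
  have h : x ∈ N.syzygy.carrier ↔ x ∈ LinearMap.range N.syzygy.genMatrix.mulVecLin := by
    rw [range_genMatrix]
  exact h

/-- The columns are relations among minimal generators, so they have no constant entries. -/
theorem constantCoeff_genMatrix_syzygy (N : GradedSubmodule K σ) (b : Fin N.genRank)
    (a : Fin N.syzygy.genRank) : constantCoeff (N.syzygy.genMatrix b a) = 0 := by
  have h : N.syzygy.genMatrix.mulVec (Pi.single a 1) ∈ N.syzygy.carrier := by
    rw [← range_genMatrix]
    exact ⟨_, rfl⟩
  have := N.genMatrix_minimal _ h b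
  rwa [Matrix.mulVec_single_one] at this

end GradedSubmodule

theorem nonempty_minimalGradedFreeResolution (I : Ideal (MvPolynomial σ K))
    (hI : ∀ D, ∀ p ∈ I, keep (fun m => m.degree = D) p ∈ I) :
    Nonempty (MinimalGradedFreeResolution I) :=
  -- The ideal is viewed inside a free module of rank one; the augmentation is the single row of its
  -- generator matrix.
  let N := GradedSubmodule.ofIdeal I hI
  let d : Matrix (Fin 1) (Fin N.genRank) (MvPolynomial σ K) := N.genMatrix
  ⟨{rank := fun i => (N.iterSyzygy i).genRank
    shift := fun i => (N.iterSyzygy i).genShift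
    gen := fun a => d 0 a
    d := fun i => (N.iterSyzygy i).syzygy.genMatrix
    gen_homogeneous := by
      intro a m hm
      have h : m.degree = N.genShift a :=
        N.genMatrix_homogeneous (0 : Fin 1) a m (mem_support_iff.2 hm)
      rwa [Finsupp.degree_eq_weight_one] at h
    d_homogeneous := fun i => (N.iterSyzygy i).syzygy.genMatrix_homogeneous
    range_gen := range_linearCombination_row (d := d) N.range_genMatrix
    exact_zero := fun x =>
      (linearCombination_row_eq_zero_iff d x).trans (N.genMatrix_syzygy_exact x)
    exact_succ := fun i => (N.iterSyzygy i).syzygy.genMatrix_syzygy_exact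
    minimal := fun i => (N.iterSyzygy i).constantCoeff_genMatrix_syzygy }⟩

end Existence

/-! ### Symbolic powers of cover ideals -/

section Symbolic

variable {K V : Type*} [Field K]

variable (K) in
/-- The homomorphism `S → S[t]` multiplying each variable `x_u` by `t ^ w u`. -/
def weightHom (w : V → ℕ) : MvPolynomial V K →ₐ[K] Polynomial (MvPolynomial V K) :=
  aeval fun u => Polynomial.C (X u) * Polynomial.X ^ w u

theorem weightHom_monomial (w : V → ℕ) (m : V →₀ ℕ) (c : K) :
    weightHom K w (monomial m c) = Polynomial.monomial (Finsupp.weight w m) (monomial m c) := by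
  rw [weightHom, aeval_monomial, monomial_eq, ← Polynomial.C_mul_X_pow_eq_monomial, map_mul,
    mul_assoc, Finsupp.weight_apply]
  congr 1
  simp only [Finsupp.prod, Finsupp.sum, mul_pow, Finset.prod_mul_distrib, map_prod, map_pow,
    ← pow_mul, Finset.prod_pow_eq_pow_sum, smul_eq_mul, mul_comm (w _)]

theorem coeff_weightHom (w : V → ℕ) (f : MvPolynomial V K) (j : ℕ) :
    (weightHom K w f).coeff j = keep (fun m => Finsupp.weight w m = j) f := by
  classical
  conv_lhs => rw [f.as_sum]
  rw [map_sum, Polynomial.finsetSum_coeff, keep, Finset.sum_filter]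
  refine Finset.sum_congr rfl fun m _ => ?_
  rw [weightHom_monomial, Polynomial.coeff_monomial]
  congr

/-- Membership in powers of an edge prime becomes divisibility by a power of the prime element `t`,
which makes cancellation available. -/
theorem X_pow_dvd_weightHom_iff (w : V → ℕ) (f : MvPolynomial V K) (k : ℕ) :
    Polynomial.X ^ k ∣ weightHom K w f ↔ ∀ m, coeff m f ≠ 0 → k ≤ Finsupp.weight w m := by
  classical
  rw [Polynomial.X_pow_dvd_iff]
  constructor
  · intro h m hm
    by_contra! hlt
    have := congrArg (coeff m) (h _ hlt)
    rw [coeff_weightHom, coeff_keep, if_pos rfl] at this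
    exact hm this
  · intro h j hj
    ext m
    rw [coeff_weightHom, coeff_keep, coeff_zero]
    by_cases hm : coeff m f = 0
    · simp [hm]
    · have := h m hm
      rw [if_neg (by omega)]

open Classical in
variable (K) in
/-- The prime ideal generated by the variables `x_v` and `x_w`. -/
def edgePrime (v w : V) : Ideal (MvPolynomial V K) :=
  (Ideal.span {Polynomial.X}).comap (weightHom K (Pi.single v 1 + Pi.single w 1))

instance isPrime_edgePrime (v w : V) : (edgePrime K v w).IsPrime := by
  classical
  have : (Ideal.span {(Polynomial.X : Polynomial (MvPolynomial V K))}).IsPrime :=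
    (Ideal.span_singleton_prime Polynomial.X_ne_zero).2 Polynomial.prime_X
  exact Ideal.comap_isPrime _ _

variable {G : SimpleGraph V}

theorem prod_mem_coverIdeal {C : Finset V} (hC : G.IsVertexCover (C : Set V)) :
    ∏ v ∈ C, X v ∈ coverIdeal K G := by
  obtain ⟨D, hD, hmin⟩ := exists_minimal_le_of_wellFoundedLT
    (fun D : Finset V => G.IsVertexCover (D : Set V)) C hC
  exact Ideal.mem_of_dvd _ (Finset.prod_dvd_prod_of_subset _ _ _ hD)
    (Ideal.subset_span ⟨D, hmin, rfl⟩)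

variable [Fintype V]

open Classical in
theorem weight_single_add_single (v w : V) (m : V →₀ ℕ) :
    Finsupp.weight (Pi.single v 1 + Pi.single w 1 : V → ℕ) m = m v + m w := by
  rw [Finsupp.weight_apply, Finsupp.sum_fintype _ _ (by simp)]
  simp [mul_add, Finset.sum_add_distrib, Pi.single_apply]

theorem mem_edgePrime {v w : V} {f : MvPolynomial V K} :
    f ∈ edgePrime K v w ↔ ∀ m, coeff m f ≠ 0 → 1 ≤ m v + m w := by
  classical
  rw [edgePrime, Ideal.mem_comap, Ideal.mem_span_singleton]
  have := X_pow_dvd_weightHom_iff (Pi.single v 1 + Pi.single w 1) f 1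
  rw [pow_one] at this
  simp only [weight_single_add_single] at this
  exact this

theorem X_mem_edgePrime {u v w : V} : (X u : MvPolynomial V K) ∈ edgePrime K v w ↔
    u = v ∨ u = w := by
  classical
  rw [mem_edgePrime]
  constructor
  · intro h
    have := h (Finsupp.single u 1) (by simp)
    by_contra! hne
    rw [Finsupp.single_apply, Finsupp.single_apply, if_neg hne.1, if_neg hne.2] at this
    omega
  · intro h m hm
    rw [coeff_X] at hm
    have : Finsupp.single u 1 = m := by
      by_contra h'
      exact hm (if_neg h')
    rw [← this]
    rcases h with rfl | rfl <;> simp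

theorem edgePrime_le {v w : V} {q : Ideal (MvPolynomial V K)} (hv : X v ∈ q) (hw : X w ∈ q) :
    edgePrime K v w ≤ q := by
  intro f hf
  rw [mem_edgePrime] at hf
  rw [f.as_sum]
  refine Ideal.sum_mem _ fun m hm => ?_
  have := hf m (mem_support_iff.1 hm)
  by_cases hmv : m v = 0
  · exact Ideal.mem_of_dvd _ (X_dvd_monomial.2 (Or.inr (by omega))) hw
  · exact Ideal.mem_of_dvd _ (X_dvd_monomial.2 (Or.inr hmv)) hv

theorem coverIdeal_le_edgePrime {v w : V} (h : G.Adj v w) :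
    coverIdeal K G ≤ edgePrime K v w := by
  refine Ideal.span_le.2 ?_
  rintro _ ⟨C, hC, rfl⟩
  rcases hC.1 h with hv | hw
  · exact Ideal.mem_of_dvd _ (Finset.dvd_prod_of_mem _ hv) (X_mem_edgePrime.2 (Or.inl rfl))
  · exact Ideal.mem_of_dvd _ (Finset.dvd_prod_of_mem _ hw) (X_mem_edgePrime.2 (Or.inr rfl))

/-- Otherwise the vertices whose variables lie outside `q` would cover all edges, and the product of
these variables would lie in the prime `q`. -/
theorem exists_adj_of_coverIdeal_le {q : Ideal (MvPolynomial V K)} [hq : q.IsPrime]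
    (h : coverIdeal K G ≤ q) : ∃ v w, G.Adj v w ∧ X v ∈ q ∧ X w ∈ q := by
  classical
  by_contra! hcon
  have hC : G.IsVertexCover ((Finset.univ.filter fun u => (X u : MvPolynomial V K) ∉ q : Finset V) :
      Set V) := by
    intro v w hvw
    by_cases hv : (X v : MvPolynomial V K) ∈ q
    · right
      simpa using hcon v w hvw hv
    · left
      simpa using hv
  have h1 : ∏ v ∈ Finset.univ.filter fun u => (X u : MvPolynomial V K) ∉ q,
      (X v : MvPolynomial V K) ∈ q.primeCompl :=
    Submonoid.prod_mem _ fun u hu => (Finset.mem_filter.1 hu).2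
  exact h1 (h (prod_mem_coverIdeal hC))

theorem mem_minimalPrimes_coverIdeal_iff {p : Ideal (MvPolynomial V K)} :
    p ∈ (coverIdeal K G).minimalPrimes ↔ ∃ v w, G.Adj v w ∧ p = edgePrime K v w := by
  constructor
  · intro hp
    have := hp.1.1
    obtain ⟨v, w, hvw, hv, hw⟩ := exists_adj_of_coverIdeal_le hp.1.2
    have hle := edgePrime_le hv hw
    exact ⟨v, w, hvw, le_antisymm
      (hp.2 ⟨isPrime_edgePrime v w, coverIdeal_le_edgePrime hvw⟩ hle) hle⟩
  · rintro ⟨v, w, hvw, rfl⟩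
    refine ⟨⟨isPrime_edgePrime v w, coverIdeal_le_edgePrime hvw⟩, ?_⟩
    rintro q ⟨hq, hJ⟩ hle
    obtain ⟨s, t, hst, hs, ht⟩ := exists_adj_of_coverIdeal_le hJ
    rcases X_mem_edgePrime.1 (hle hs) with rfl | rfl <;>
      rcases X_mem_edgePrime.1 (hle ht) with rfl | rfl
    · exact absurd rfl hst.ne
    · exact edgePrime_le hs ht
    · exact edgePrime_le ht hs
    · exact absurd rfl hst.ne

/-- After `weightHom`, `t ^ k` divides the image of `s * f` while `t` does not divide that of `s`;
as `t` is prime, `t ^ k` divides the image of `f`. -/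
theorem le_of_mul_mem_coverIdeal_pow {v w : V} (h : G.Adj v w) {k : ℕ} {s f : MvPolynomial V K}
    (hs : s ∉ edgePrime K v w) (hsf : s * f ∈ coverIdeal K G ^ k) {m : V →₀ ℕ}
    (hm : coeff m f ≠ 0) : k ≤ m v + m w := by
  classical
  have h1 : coverIdeal K G ^ k ≤ (Ideal.span {Polynomial.X ^ k}).comap
      (weightHom K (Pi.single v 1 + Pi.single w 1)) := by
    rw [← Ideal.span_singleton_pow]
    exact (Ideal.pow_right_mono (coverIdeal_le_edgePrime h) k).trans (Ideal.le_comap_pow _ k)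
  have h2 := h1 hsf
  rw [Ideal.mem_comap, Ideal.mem_span_singleton, map_mul] at h2
  rw [edgePrime, Ideal.mem_comap, Ideal.mem_span_singleton] at hs
  have h3 := Polynomial.prime_X.pow_dvd_of_dvd_mul_left k hs h2
  rw [X_pow_dvd_weightHom_iff] at h3
  rw [← weight_single_add_single]
  exact h3 m hm

-- All vertices except `w` form a vertex cover, because no edge is a loop at `w`.
open Classical in
theorem prod_mul_X_mem_coverIdeal {v w : V} (h : v ≠ w) :
    (∏ u ∈ (Finset.univ.erase v).erase w, X u) * X v ∈ coverIdeal K G := by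
  have hv : v ∉ (Finset.univ.erase v).erase w := by simp
  rw [mul_comm, ← Finset.prod_insert hv]
  refine prod_mem_coverIdeal ?_
  intro s t hst
  by_cases hs : s = w
  · right
    subst hs
    by_cases ht : t = v <;> simp [ht, hst.ne.symm]
  · left
    by_cases hsv : s = v <;> simp [hs, hsv]

/-- With `s` the product of the other variables, `s * X v` and `s * X w` lie in the cover ideal.
Each monomial of `f` is divisible by some `X v ^ a * X w ^ b` with `a + b = k`, so `s ^ k` works for
all of them. -/
theorem exists_mul_mem_coverIdeal_pow {v w : V} (h : v ≠ w) {k : ℕ} {f : MvPolynomial V K}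
    (hf : ∀ m, coeff m f ≠ 0 → k ≤ m v + m w) :
    ∃ s ∉ edgePrime K v w, s * f ∈ coverIdeal K G ^ k := by
  classical
  set s : MvPolynomial V K := ∏ u ∈ (Finset.univ.erase v).erase w, X u with hs
  refine ⟨s ^ k, ?_, ?_⟩
  · have h1 : s ∈ (edgePrime K v w).primeCompl := by
      refine Submonoid.prod_mem _ fun u hu => ?_
      rw [Finset.mem_erase, Finset.mem_erase] at hu
      exact fun h' => (X_mem_edgePrime.1 h').elim hu.2.1 hu.1
    exact Submonoid.pow_mem _ h1 k
  · rw [f.as_sum, Finset.mul_sum]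
    refine Ideal.sum_mem _ fun m hm => ?_
    have hk := hf m (mem_support_iff.1 hm)
    obtain ⟨a, b, ha, hb, rfl⟩ : ∃ a b, a ≤ m v ∧ b ≤ m w ∧ a + b = k :=
      ⟨min k (m v), k - min k (m v), by omega, by omega, by omega⟩
    have h1 : s * X v ∈ coverIdeal K G := prod_mul_X_mem_coverIdeal h
    have h2 : s * X w ∈ coverIdeal K G := by
      rw [hs, Finset.erase_right_comm]
      exact prod_mul_X_mem_coverIdeal h.symm
    have h3 : (s * X v) ^ a * (s * X w) ^ b ∈ coverIdeal K G ^ (a + b) := by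
      rw [pow_add]
      exact Ideal.mul_mem_mul (Ideal.pow_mem_pow h1 a) (Ideal.pow_mem_pow h2 b)
    refine Ideal.mem_of_dvd _ ?_ h3
    have h4 : (X v ^ a * X w ^ b : MvPolynomial V K) ∣ monomial m (coeff m f) := by
      rw [X_pow_eq_monomial, X_pow_eq_monomial, monomial_mul, one_mul, monomial_dvd_monomial]
      refine ⟨Or.inr fun u => ?_, one_dvd _⟩
      rw [Finsupp.add_apply, Finsupp.single_apply, Finsupp.single_apply]
      by_cases hu : v = u
      · subst hu
        rw [if_pos rfl, if_neg h.symm]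
        omega
      · by_cases hu' : w = u
        · subst hu'
          rw [if_neg hu, if_pos rfl]
          omega
        · rw [if_neg hu, if_neg hu']
          omega
    have h5 : (s * X v) ^ a * (s * X w) ^ b = s ^ (a + b) * (X v ^ a * X w ^ b) := by ring
    rw [h5]
    exact mul_dvd_mul_left _ h4

theorem mem_symbolicPower_iff {R : Type*} [CommRing R] {I : Ideal R} {k : ℕ} {f : R} :
    f ∈ symbolicPower I k ↔ ∀ p ∈ I.minimalPrimes, ∃ s ∉ p, s * f ∈ I ^ k := by
  rw [symbolicPower, Submodule.mem_iInf]
  refine forall_congr' fun p => ?_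
  rw [Submodule.mem_iInf]
  refine forall_congr' fun hp => ?_
  have : p.IsPrime := hp.1.1
  rw [LinearMap.mem_ker, LinearMap.comp_apply, ← LinearMap.mem_ker,
    LocalizedModule.mem_ker_mkLinearMap_iff]
  refine exists_congr fun s => and_congr Iff.rfl ?_
  rw [← map_smul, Submodule.mkQ_apply, Submodule.Quotient.mk_eq_zero, smul_eq_mul]

theorem mem_symbolicPower_coverIdeal_iff {k : ℕ} {f : MvPolynomial V K} :
    f ∈ symbolicPower (coverIdeal K G) k ↔ ∀ m, coeff m f ≠ 0 → m ∈ symbolicExps G k := by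
  rw [mem_symbolicPower_iff]
  constructor
  · intro h m hm v w hvw
    obtain ⟨s, hs, hsf⟩ := h _ (mem_minimalPrimes_coverIdeal_iff.2 ⟨v, w, hvw, rfl⟩)
    exact le_of_mul_mem_coverIdeal_pow hvw hs hsf hm
  · intro h p hp
    obtain ⟨v, w, hvw, rfl⟩ := mem_minimalPrimes_coverIdeal_iff.1 hp
    exact exists_mul_mem_coverIdeal_pow hvw.ne fun m hm => h m hm v w hvw

theorem monomial_mem_coverIdeal_iff {m : V →₀ ℕ} :
    monomial m (1 : K) ∈ coverIdeal K G ↔ m ∈ symbolicExps G 1 := by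
  classical
  constructor
  · intro h v w hvw
    refine mem_edgePrime.1 (coverIdeal_le_edgePrime hvw h) m ?_
    rw [coeff_monomial, if_pos rfl]
    exact one_ne_zero
  · intro h
    have hC : G.IsVertexCover (m.support : Set V) := by
      intro v w hvw
      have := h v w hvw
      simp only [Finset.mem_coe, Finsupp.mem_support_iff]
      omega
    refine Ideal.mem_of_dvd _ ?_ (prod_mem_coverIdeal hC)
    rw [monomial_eq, C_1, one_mul]
    exact Finset.prod_dvd_prod_of_dvd _ _ fun u hu =>
      dvd_pow_self _ (Finsupp.mem_support_iff.1 hu)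

end Symbolic

/-! ### Graphs with a universal vertex -/

section Universal

variable {K V : Type*} [Field K] [Fintype V] {G : SimpleGraph V} {y : V}

open Classical in
/-- The exponent `k` at all vertices different from `y`. -/
def topExp (y : V) (k : ℕ) : V →₀ ℕ := k • faceExp (Finset.univ.erase y)

theorem topExp_apply_self (y : V) (k : ℕ) : topExp y k y = 0 := by
  classical
  rw [topExp, Finsupp.smul_apply, faceExp_apply_of_notMem (Finset.notMem_erase _ _), smul_zero]

theorem topExp_apply_of_ne {v : V} (h : v ≠ y) (k : ℕ) : topExp y k v = k := by
  classical
  rw [topExp, Finsupp.smul_apply, faceExp_apply_of_mem (Finset.mem_erase.2 ⟨h, Finset.mem_univ v⟩),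
    smul_eq_mul, mul_one]

theorem degree_topExp {n : ℕ} (hn : Fintype.card V = n + 1) (y : V) (k : ℕ) :
    (topExp y k).degree = k * n := by
  classical
  rw [topExp, map_nsmul, degree_faceExp, Finset.card_erase_of_mem (Finset.mem_univ y),
    Finset.card_univ, hn, smul_eq_mul, Nat.add_sub_cancel]

/-- The zero at `y` forces every neighbour of `y` to have exponent at least `k`, and all other
vertices are neighbours. -/
theorem minimal_topExp (hy : ∀ v, v ≠ y → G.Adj y v) (k : ℕ) :
    Minimal (· ∈ symbolicExps G k) (topExp y k) := by
  constructor
  · intro v w hvw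
    by_cases hv : v = y
    · rw [topExp_apply_of_ne (v := w) (by rw [← hv]; exact hvw.ne.symm)]
      omega
    · rw [topExp_apply_of_ne hv]
      omega
  · intro m hm hle v
    have h0 := hle y
    rw [topExp_apply_self] at h0
    by_cases hv : v = y
    · rw [hv, topExp_apply_self]
      exact Nat.zero_le _
    · have := hm y v (hy v hv)
      rw [topExp_apply_of_ne hv]
      omega

/-- Minimality caps all entries at `1`, and some entry is `0`: if none were, any single vertex could
be erased, since each edge has another end. -/
theorem degree_le_of_minimal {n : ℕ} (hn : Fintype.card V = n + 1)
    {m : V →₀ ℕ} (hm : Minimal (· ∈ symbolicExps G 1) m) : m.degree ≤ n := by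
  classical
  have : Nonempty V := Fintype.card_pos_iff.1 (by omega)
  obtain ⟨y⟩ := this
  have hle : ∀ u, m u ≤ 1 := by
    intro u
    have h1 : m ⊓ faceExp Finset.univ ∈ symbolicExps G 1 := by
      intro v w hvw
      have := hm.1 v w hvw
      rw [Finsupp.inf_apply, Finsupp.inf_apply, faceExp_apply_of_mem (Finset.mem_univ v),
        faceExp_apply_of_mem (Finset.mem_univ w)]
      omega
    have h2 := hm.2 h1 inf_le_left u
    rw [Finsupp.inf_apply, faceExp_apply_of_mem (Finset.mem_univ u)] at h2
    omega
  have hex : ∃ u, m u = 0 := by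
    by_contra! hne
    have h1 : m.erase y ∈ symbolicExps G 1 := by
      intro v w hvw
      by_cases hv : v = y
      · have := hne w
        rw [Finsupp.erase_ne (a' := w) (by rw [← hv]; exact hvw.ne.symm)]
        omega
      · have := hne v
        rw [Finsupp.erase_ne hv]
        omega
    have h2 : m.erase y ≤ m := by
      intro u
      by_cases hu : u = y
      · rw [hu, Finsupp.erase_same]
        exact Nat.zero_le _
      · rw [Finsupp.erase_ne hu]
    have h3 := hm.2 h1 h2 y
    rw [Finsupp.erase_same] at h3
    exact hne y (by omega)
  obtain ⟨u, hu⟩ := hex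
  rw [Finsupp.degree_eq_sum, ← Finset.add_sum_erase _ _ (Finset.mem_univ u), hu, zero_add]
  refine (Finset.sum_le_card_nsmul _ _ 1 fun v _ => hle v).trans ?_
  rw [Finset.card_erase_of_mem (Finset.mem_univ u), Finset.card_univ, hn, smul_eq_mul, mul_one,
    Nat.add_sub_cancel]

theorem monomialIdealDegree_coverIdeal {n : ℕ} (hn : Fintype.card V = n + 1)
    (hy : ∀ v, v ≠ y → G.Adj y v) : monomialIdealDegree (coverIdeal K G) = n := by
  have hmem : ∀ m, m ∈ (minimalMonomials_finite (coverIdeal K G)).toFinset ↔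
      Minimal (· ∈ symbolicExps G 1) m := by
    intro m
    rw [Set.Finite.mem_toFinset]
    simp only [minimalMonomials, Set.mem_ofPred_eq, monomial_mem_coverIdeal_iff]
  refine le_antisymm (Finset.sup_le fun m hm => degree_le_of_minimal hn ((hmem m).1 hm)) ?_
  have := Finset.le_sup (f := Finsupp.degree) ((hmem _).2 (minimal_topExp hy 1))
  rwa [degree_topExp hn, one_mul] at this

theorem shift_le {n k : ℕ} (hn : Fintype.card V = n + 1) {I : Ideal (MvPolynomial V K)}
    (hI : ∀ p, p ∈ I ↔ ∀ m, coeff m p ≠ 0 → m ∈ symbolicExps G k)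
    (F : MinimalGradedFreeResolution I) (i : ℕ) (a : Fin (F.rank i)) :
    F.shift i a ≤ k * n + i := by
  -- The order only serves to define the Koszul signs.
  let : LinearOrder V := LinearOrder.lift' (Fintype.equivFin V) (Fintype.equivFin V).injective
  obtain _ | i := i
  · obtain ⟨b, hb, hdeg, hmin⟩ := F.exists_multidegree_zero hI a
    rw [← hdeg, Finsupp.degree_eq_sum]
    refine sum_le_of_forall_adj (G := G) hn fun v hv => ?_
    have he : b - Finsupp.single v 1 + Finsupp.single v 1 = b :=
      tsub_add_cancel_of_le (Finsupp.single_le_iff.2 (Nat.one_le_iff_ne_zero.2 hv))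
    obtain ⟨w, hw, hsum⟩ := exists_adj_of_notMem_symbolicExps (he.symm ▸ hb) (hmin v _ he)
    refine ⟨w, hw, ?_⟩
    rw [← hsum, ← he]
    simp [hw.ne]
  · obtain ⟨b, hdeg, -, hcone⟩ := F.exists_multidegree_succ hI i a
    rw [← hdeg, Finsupp.degree_eq_sum]
    -- The bound `k * n + 1` does not grow with the homological degree, here `i + 1 ≥ 1`.
    refine (sum_le_of_forall_adj_or (G := G) (k := k) hn fun v hv => ?_).trans (by omega)
    obtain ⟨ρ, m, he, hm, hvρ, hm'⟩ := hcone v hv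
    obtain ⟨w, hw, hsum⟩ := exists_adj_of_notMem_symbolicExps hm hm'
    have hbv : b v = m v + 1 := by
      rw [← he, Finsupp.add_apply, Finsupp.add_apply, Finsupp.single_eq_same,
        faceExp_apply_of_notMem hvρ, add_zero]
    have hbw : b w = m w + faceExp ρ w := by
      rw [← he, Finsupp.add_apply, Finsupp.add_apply, Finsupp.single_eq_of_ne hw.ne.symm, add_zero]
    refine ⟨w, hw, ?_⟩
    -- Since `v ∉ ρ`, the face adds nothing at `v`. Whether it contains `w` decides between a sum of
    -- `k + 1`, with `b w ≠ 0`, and a sum of `k`.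
    by_cases hwρ : w ∈ ρ
    · rw [faceExp_apply_of_mem hwρ] at hbw
      right
      omega
    · rw [faceExp_apply_of_notMem hwρ] at hbw
      left
      omega

theorem isRegularity_symbolicPower {n : ℕ} (hn : Fintype.card V = n + 1)
    (hy : ∀ v, v ≠ y → G.Adj y v) (k : ℕ) :
    IsRegularity (symbolicPower (coverIdeal K G) k) ((k : ℤ) * (n : ℤ)) := by
  have hI : ∀ p, p ∈ symbolicPower (coverIdeal K G) k ↔
      ∀ m, coeff m p ≠ 0 → m ∈ symbolicExps G k := fun p => mem_symbolicPower_coverIdeal_iff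
  refine ⟨nonempty_minimalGradedFreeResolution _ fun D p hp => ?_, fun F => ⟨?_, ?_⟩⟩
  · rw [hI] at hp ⊢
    exact fun m hm => hp m (coeff_keep_ne_zero hm).2
  · obtain ⟨a, ha⟩ := F.exists_shift_zero_eq hI (minimal_topExp hy k)
    rw [degree_topExp hn] at ha
    -- The maximum is already attained in homological degree `0`.
    refine ⟨0, k * n, ?_, by push_cast; ring⟩
    rw [MinimalGradedFreeResolution.betti, Finset.card_ne_zero]
    exact ⟨a, Finset.mem_filter.2 ⟨Finset.mem_univ a, ha⟩⟩
  · rintro _ ⟨i, j, hij, rfl⟩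
    rw [MinimalGradedFreeResolution.betti, Finset.card_ne_zero] at hij
    obtain ⟨a, ha⟩ := hij
    rw [Finset.mem_filter] at ha
    have := shift_le hn hI F i a
    rw [ha.2] at this
    zify at this
    linarith

end Universal

end CoverIdeals

end

theorem corollary3p8 (K : Type*) [Field K] (k : ℕ) (hk : 1 ≤ k) :
    (∀ (V : Type*) [Fintype V] (H : SimpleGraph V), H.indepNum ≤ 2 →
      CoverIdeals.IsRegularity
          (CoverIdeals.symbolicPower (CoverIdeals.coverIdeal K (CoverIdeals.cone H)) k)
          ((k : ℤ) *
            (CoverIdeals.monomialIdealDegree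
              (CoverIdeals.coverIdeal K (CoverIdeals.cone H)) : ℤ)) ∧
        (k : ℤ) *
            (CoverIdeals.monomialIdealDegree
              (CoverIdeals.coverIdeal K (CoverIdeals.cone H)) : ℤ) =
          ((k : ℤ) - 1) *
            (CoverIdeals.monomialIdealDegree
              (CoverIdeals.coverIdeal K (CoverIdeals.cone H)) : ℤ) +
            (Fintype.card (Option V) : ℤ) - 1) ∧
    (∀ n : ℕ, 2 ≤ n →
      CoverIdeals.IsRegularity
        (CoverIdeals.symbolicPower
          (CoverIdeals.coverIdeal K (⊤ : SimpleGraph (Fin n))) k)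
        ((k : ℤ) * ((n : ℤ) - 1))) := by
  constructor
  · intro V _ H _
    have hy : ∀ v, v ≠ none → (CoverIdeals.cone H).Adj none v := by
      rintro (_ | v) hv
      · exact absurd rfl hv
      · trivial
    have hn : Fintype.card (Option V) = Fintype.card V + 1 := Fintype.card_option
    rw [CoverIdeals.monomialIdealDegree_coverIdeal hn hy]
    refine ⟨CoverIdeals.isRegularity_symbolicPower hn hy k, ?_⟩
    rw [hn]
    push_cast
    ring
  · intro n hn
    -- The complete graph is treated directly, with `0` as universal vertex, rather than being
    -- identified with a cone.
    obtain ⟨r, rfl⟩ := Nat.exists_eq_add_of_le' (le_trans one_le_two hn)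
    have := CoverIdeals.isRegularity_symbolicPower (K := K) (G := (⊤ : SimpleGraph (Fin (r + 1))))
      (y := 0) (Fintype.card_fin (r + 1)) (fun v hv => Ne.symm hv) k
    rwa [Nat.cast_add, Nat.cast_one, add_sub_cancel_right]
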